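/- Let $d\ge 1$ and let $Z(t)$, $t\in\mathbb R^d$, be a non-negative random field whose sample paths are almost surely (generalised, i.e. quadrant-wise) càdlàg, such that $E[Z(t)]=1$ for all $t\in\mathbb R^d$, $E[\sup_{t\in[0,T]^d}Z(t)]<\infty$ for all $T>0$, and $P(\sup_{t\in\mathbb R^d}Z(t)>0)=1$. Let $\Gamma_i=\mathcal V_1+\dots+\mathcal V_i$ with independent unit exponential random variables $\mathcal V_k$, let $Z^{(1)},Z^{(2)},\dots$ be independent copies of $Z$, independent of $(\mathcal V_k)_{k\ge1}$, and suppose that the max-stable random field $$X(t)=\max_{i\ge1}\Gamma_i^{-1}Z^{(i)}(t),\qquad t\in\mathbb R^d,$$ is stationary. Let $\Theta$ be a random field with càdlàg sample paths and law $\mu(A)=E[Z(0)\mathbf 1\{Z/Z(0)\in A\}]$, let $R$ be independent of $\Theta$ with $P(R>r)=1/r$ for $r\ge1$, and put $Y(t)=R\,\Theta(t)$. For $\delta>0$ let $\lambda_\delta$ be $\delta^d$ times the counting measure on $\delta\mathbb Z^d$; for $\delta=0$ put $0\mathbb Z^d=\mathbb R^d$ and let $\lambda_0$ be Lebesgue measure.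 Define $$\epsilon_\delta(Y)=\int_{\delta\mathbb Z^d}\mathbf 1\{Y(t)>1\}\,\lambda_\delta(dt)\in[0,\infty]$$ and the Berman function $$\mathcal B_Z^\delta(x)=\lim_{T\to\infty}\frac1{T^d}\int_0^\infty P\Big(\int_{[0,T]^d\cap\delta\mathbb Z^d}\mathbf 1\{Z(t)>s\}\,\lambda_\delta(dt)>x\Big)\,ds .$$ Then for all $\delta\ge0$ and $x>0$ the limit defining $\mathcal B_Z^\delta(x)$ exists, and $$\frac{P(\epsilon_\delta(Y)>x)^2}{E[\epsilon_\delta(Y)]}\le \mathcal B_Z^\delta(x)\le x^{-1}P(\epsilon_\delta(Y)\ge x),$$ where the left-hand side is read as $0$ if $E[\epsilon_\delta(Y)]=\infty$. -/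

import Mathlib

open MeasureTheory ProbabilityTheory Filter Topology
open scoped ENNReal NNReal

noncomputable section

/-- Generalised càdlàg functions `ℝ^d → [0, ∞)`: at every point `t` the function has a finite limit
along each of the `2^d` quadrants `{s | s_i ≥ t_i for i ∈ E, s_i < t_i for i ∉ E}`. The quadrant with
`E` everything contains `t`, so that the limit along it is the value at `t` ("right-continuity"). -/
def IsCadlag {d : ℕ} (f : (Fin d → ℝ) → ℝ≥0) : Prop :=
  ∀ (t : Fin d → ℝ) (E : Set (Fin d)), ∃ l : ℝ≥0,
    Tendsto f (𝓝[{s | ∀ i, (i ∈ E → t i ≤ s i) ∧ (i ∉ E → s i < t i)}] t) (𝓝 l)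

/-- The measure `λ_δ`: Lebesgue measure on `ℝ^d` for `δ = 0`, and `δ^d` times the counting measure
on the lattice `δ ℤ^d` (regarded as a measure on `ℝ^d`) otherwise. -/
def gridMeasure (d : ℕ) (δ : ℝ) : Measure (Fin d → ℝ) :=
  if δ = 0 then volume
  else ENNReal.ofReal (δ ^ d) •
    Measure.sum (fun k : Fin d → ℤ => Measure.dirac (fun i => δ * (k i : ℝ)))

/-- The sojourn `∫_{A ∩ δℤ^d} 1{f(t) > s} λ_δ(dt)`; recall that `λ_δ` is carried by `δℤ^d`. -/
def sojourn {d : ℕ} (δ : ℝ) (A : Set (Fin d → ℝ)) (f : (Fin d → ℝ) → ℝ) (s : ℝ) : ℝ≥0∞ :=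
  gridMeasure d δ (A ∩ {t | s < f t})

/-- The cube `[0,T]^d`. -/
def cube (d : ℕ) (T : ℝ) : Set (Fin d → ℝ) := Set.Icc 0 (fun _ => T)

/-- A random field with nonnegative values, unit mean, almost surely càdlàg sample paths, integrable
suprema over cubes, and which almost surely is not identically zero. -/
structure IsSpectralField {Ω : Type*} [MeasurableSpace Ω] (P : Measure Ω) {d : ℕ}
    (Z : Ω → (Fin d → ℝ) → ℝ≥0) : Prop where
  measurable : ∀ t, Measurable (fun ω => Z ω t)
  cadlag : ∀ᵐ ω ∂P, IsCadlag (Z ω)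
  mean_one : ∀ t, ∫⁻ ω, (Z ω t : ℝ≥0∞) ∂P = 1
  sup_integrable : ∀ T : ℝ, 0 < T → ∫⁻ ω, (⨆ t ∈ cube d T, (Z ω t : ℝ≥0∞)) ∂P < ∞
  sup_pos : ∀ᵐ ω ∂P, 0 < ⨆ t, (Z ω t : ℝ≥0∞)

/-- The ingredients of the de Haan representation with spectral field `Z`: independent unit
exponential variables `V 0, V 1, …`, and, independent of them, independent copies
`W 0, W 1, …` of `Z`. -/
structure IsDeHaanSample {Ω Ω₁ : Type*} [MeasurableSpace Ω] [MeasurableSpace Ω₁]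
    (P : Measure Ω) {d : ℕ} (Z : Ω → (Fin d → ℝ) → ℝ≥0) (P₁ : Measure Ω₁)
    (V : ℕ → Ω₁ → ℝ) (W : ℕ → Ω₁ → (Fin d → ℝ) → ℝ≥0) : Prop where
  measurable_V : ∀ k, Measurable (V k)
  law_V : ∀ k, P₁.map (V k) = expMeasure 1
  indep_V : iIndepFun V P₁
  measurable_W : ∀ i, Measurable (W i)
  law_W : ∀ i, P₁.map (W i) = P.map Z
  indep_W : iIndepFun W P₁
  indep_VW : IndepFun (fun ω k => V k ω) (fun ω i => W i ω) P₁

/-- The max-stable field `X(t) = max_{i ≥ 1} Γ_i⁻¹ Z^{(i)}(t)`, where `Γ_i = V_1 + ⋯ + V_i`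
(the indices start from `0` here). -/
def deHaanField {Ω₁ : Type*} {d : ℕ} (V : ℕ → Ω₁ → ℝ) (W : ℕ → Ω₁ → (Fin d → ℝ) → ℝ≥0)
    (t : Fin d → ℝ) (ω : Ω₁) : ℝ≥0∞ :=
  ⨆ i : ℕ, (W i ω t : ℝ≥0∞) / ENNReal.ofReal (∑ k ∈ Finset.range (i + 1), V k ω)

/-- Stationarity: the finite-dimensional distributions are invariant under all shifts. -/
def IsStationaryField {Ω₁ : Type*} [MeasurableSpace Ω₁] (P₁ : Measure Ω₁) {d : ℕ}
    (X : (Fin d → ℝ) → Ω₁ → ℝ≥0∞) : Prop :=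
  ∀ (n : ℕ) (t : Fin n → Fin d → ℝ) (h : Fin d → ℝ),
    IdentDistrib (fun ω j => X (t j + h) ω) (fun ω j => X (t j) ω) P₁ P₁

/-- The law `μ(A) = E[Z(0) 1{Z / Z(0) ∈ A}]` on paths, for the σ-field generated by the projections. -/
def tiltedLaw {Ω : Type*} [MeasurableSpace Ω] (P : Measure Ω) {d : ℕ}
    (Z : Ω → (Fin d → ℝ) → ℝ≥0) : Measure ((Fin d → ℝ) → ℝ≥0) :=
  (P.withDensity (fun ω => (Z ω 0 : ℝ≥0∞))).map (fun ω t => Z ω t / Z ω 0)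

/-- `R` is a 1-Pareto variable (survival function `1/r` for `r ≥ 1`), independent of the field `Θ`,
which has law `μ` and almost surely càdlàg sample paths. -/
structure IsParetoTilted {Ω Ω₂ : Type*} [MeasurableSpace Ω] [MeasurableSpace Ω₂]
    (P : Measure Ω) {d : ℕ} (Z : Ω → (Fin d → ℝ) → ℝ≥0) (P₂ : Measure Ω₂)
    (R : Ω₂ → ℝ) (Θ : Ω₂ → (Fin d → ℝ) → ℝ≥0) : Prop where
  measurable_R : Measurable R
  survival_R : ∀ r : ℝ, 1 ≤ r → P₂ {ω | r < R ω} = ENNReal.ofReal (1 / r)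
  measurable_Θ : Measurable Θ
  cadlag_Θ : ∀ᵐ ω ∂P₂, IsCadlag (Θ ω)
  law_Θ : P₂.map Θ = tiltedLaw P Z
  indep : IndepFun R Θ P₂

/-- `ε_δ(Y) = ∫_{δℤ^d} 1{Y(t) > 1} λ_δ(dt)` for `Y(t) = R Θ(t)`. -/
def sojournY {Ω₂ : Type*} {d : ℕ} (δ : ℝ) (R : Ω₂ → ℝ) (Θ : Ω₂ → (Fin d → ℝ) → ℝ≥0)
    (ω : Ω₂) : ℝ≥0∞ :=
  sojourn δ Set.univ (fun t => R ω * (Θ ω t : ℝ)) 1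

/-- `B_Z^δ([0,T]^d ∩ δℤ^d, x) = ∫_0^∞ P(∫_{[0,T]^d ∩ δℤ^d} 1{Z(t) > s} λ_δ(dt) > x) ds`. -/
def bermanPre {Ω : Type*} [MeasurableSpace Ω] (P : Measure Ω) {d : ℕ}
    (Z : Ω → (Fin d → ℝ) → ℝ≥0) (δ T x : ℝ) : ℝ≥0∞ :=
  ∫⁻ s in Set.Ioi (0 : ℝ),
    P {ω | ENNReal.ofReal x < sojourn δ (cube d T) (fun t => (Z ω t : ℝ)) s}

/-- The Berman function `B_Z^δ(x) = lim_{T → ∞} T^{-d} B_Z^δ([0,T]^d ∩ δℤ^d, x)`. -/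
def bermanFun {Ω : Type*} [MeasurableSpace Ω] (P : Measure Ω) {d : ℕ}
    (Z : Ω → (Fin d → ℝ) → ℝ≥0) (δ x : ℝ) : ℝ≥0∞ :=
  limUnder atTop (fun T : ℝ => bermanPre P Z δ T x / ENNReal.ofReal (T ^ d))

end

/-!
Let `m` be the measure on paths with `m(A) = ∫_0^∞ P(Z / s ∈ A) ds`, and let `S_A(f)` be the
`λ_δ`-volume of `{t ∈ A | f(t) > 1}`, so that the integral in the definition of the Berman function
is `m(S_{[0,T]^d} > x)`. The void probabilities of the Poisson process `(Γ_i)` give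
`P(X(t_j) ≤ c_j for all j) = exp(-m(f(t_j) > c_j for some j))`. Hence stationarity of `X` says that
`m` is invariant under shifts, once it is restricted to the paths exceeding one at a given point.
The restriction of `m` to `{f | f(0) > 1}` is the law of `Y = R Θ`.

With `g(y) = 1{y > x} / y` one has `1{S_A > x} = ∫_A 1{f(t) > 1} g(S_A(f)) λ_δ(dt)`, so Fubini's
theorem and the shift invariance turn `m(S_{[0,T]^d} > x)` into
`∫_{[0,T]^d} E[g(S_{[0,T]^d - t}(Y))] λ_δ(dt)`. Away from the boundary of the cube the integrand is
close to `E[g(ε_δ(Y))]`, which is therefore the limit of the averages. The upper bound is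
`g(y) ≤ x⁻¹ 1{y ≥ x}` and the lower bound is the Cauchy-Schwarz inequality for
`1{ε_δ(Y) > x} = g(ε_δ(Y))^{1/2} ε_δ(Y)^{1/2}`.
-/

section RightContinuity

variable {d : ℕ}

/-- Right-continuity along quadrants: at every `t` the path is continuous along
`{s | t_i ≤ s_i for all i}`. Such a path is determined by its values on a countable set. -/
def IsRightCont (f : (Fin d → ℝ) → ℝ≥0) : Prop :=
  ∀ t, ContinuousWithinAt f (Set.Ici t) t

lemma IsCadlag.isRightCont {f : (Fin d → ℝ) → ℝ≥0} (hf : IsCadlag f) : IsRightCont f := by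
  intro t
  obtain ⟨l, hl⟩ := hf t Set.univ
  have hquadrant : {s | ∀ i, (i ∈ (Set.univ : Set (Fin d)) → t i ≤ s i) ∧
      (i ∉ (Set.univ : Set (Fin d)) → s i < t i)} = Set.Ici t := by
    ext s
    simp [Pi.le_def]
  rw [hquadrant] at hl
  have hlim : f t = l := tendsto_nhds_unique (tendsto_pure_nhds f t)
    (hl.mono_left (pure_le_nhdsWithin Set.self_mem_Ici))
  rwa [ContinuousWithinAt, hlim]

namespace IsRightCont

variable {f : (Fin d → ℝ) → ℝ≥0}

lemma comp_add_right (hf : IsRightCont f) (h : Fin d → ℝ) : IsRightCont fun t => f (t + h) :=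
  fun t => (hf (t + h)).comp (f := (· + h)) (continuous_add_const h).continuousWithinAt
    fun _ hs => add_le_add_left (Set.mem_Ici.1 hs) h

lemma const_mul (hf : IsRightCont f) (c : ℝ≥0) : IsRightCont fun t => c * f t :=
  fun t => (hf t).const_mul c

lemma div_const (hf : IsRightCont f) (c : ℝ≥0) : IsRightCont fun t => f t / c :=
  fun t => (hf t).div_const c

end IsRightCont

/-- The smallest point of the lattice `(n + 1)⁻¹ ℤ^d` that is strictly above `t`. -/
noncomputable def upperLatticePoint (n : ℕ) (t : Fin d → ℝ) : Fin d → ℝ :=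
  fun i => ((⌊((n : ℝ) + 1) * t i⌋ : ℝ) + 1) / ((n : ℝ) + 1)

lemma lt_upperLatticePoint (n : ℕ) (t : Fin d → ℝ) (i : Fin d) :
    t i < upperLatticePoint n t i := by
  rw [upperLatticePoint, lt_div_iff₀ (by positivity), mul_comm]
  exact Int.lt_floor_add_one _

lemma upperLatticePoint_le (n : ℕ) (t : Fin d → ℝ) (i : Fin d) :
    upperLatticePoint n t i ≤ t i + 1 / ((n : ℝ) + 1) := by
  rw [upperLatticePoint, ← sub_le_iff_le_add, ← sub_div, add_sub_cancel_right,
    div_le_iff₀ (by positivity), mul_comm (t i)]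
  exact Int.floor_le _

lemma tendsto_upperLatticePoint (t : Fin d → ℝ) :
    Tendsto (fun n => upperLatticePoint n t) atTop (𝓝[≥] t) := by
  refine tendsto_nhdsWithin_iff.2 ⟨tendsto_pi_nhds.2 fun i => ?_,
    Eventually.of_forall fun n i => (lt_upperLatticePoint n t i).le⟩
  refine tendsto_of_tendsto_of_tendsto_of_le_of_le tendsto_const_nhds ?_
    (fun n => (lt_upperLatticePoint n t i).le) (fun n => upperLatticePoint_le n t i)
  simpa using tendsto_one_div_add_atTop_nhds_zero_nat.const_add (t i)

/-- A right-continuous path is recovered from its values on countably many lattices. The resulting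
functional is jointly measurable in the path and the argument, which evaluation is not: the set of
right-continuous paths is not measurable in the σ-field generated by the projections. -/
noncomputable def rightRegularization (f : (Fin d → ℝ) → ℝ≥0) (t : Fin d → ℝ) : ℝ≥0 :=
  (liminf (fun n => (f (upperLatticePoint n t) : ℝ≥0∞)) atTop).toNNReal

lemma IsRightCont.rightRegularization_eq {f : (Fin d → ℝ) → ℝ≥0} (hf : IsRightCont f) :
    rightRegularization f = f := by
  funext t
  have hlim := ENNReal.tendsto_coe.2 ((hf t).tendsto.comp (tendsto_upperLatticePoint t))
  rw [rightRegularization, ← ENNReal.toNNReal_coe (f t), ← hlim.liminf_eq]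
  rfl

lemma measurable_rightRegularization :
    Measurable fun p : ((Fin d → ℝ) → ℝ≥0) × (Fin d → ℝ) => rightRegularization p.1 p.2 := by
  refine (Measurable.liminf fun n => ?_).ennreal_toNNReal
  have heval : Measurable fun p : ((Fin d → ℝ) → ℝ≥0) × (Fin d → ℤ) =>
      (p.1 (fun i => ((p.2 i : ℝ) + 1) / ((n : ℝ) + 1)) : ℝ≥0∞) :=
    measurable_from_prod_countable_left fun k =>
      (measurable_pi_apply (fun i => ((k i : ℝ) + 1) / ((n : ℝ) + 1))).coe_nnreal_ennreal
  have hfloor : Measurable fun p : ((Fin d → ℝ) → ℝ≥0) × (Fin d → ℝ) =>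
      (p.1, fun i => ⌊((n : ℝ) + 1) * p.2 i⌋) :=
    measurable_fst.prodMk <| measurable_pi_lambda _ fun i => Int.measurable_floor.comp
      (((measurable_pi_apply i).comp measurable_snd).const_mul _)
  exact heval.comp hfloor

end RightContinuity

section ExceedanceVolume

variable {d : ℕ} {μ : Measure (Fin d → ℝ)} {A B : Set (Fin d → ℝ)}

/-- The volume, with respect to `μ`, of the part of `A` where the path exceeds the level one. -/
noncomputable def exceedanceVolume (μ : Measure (Fin d → ℝ)) (A : Set (Fin d → ℝ))
    (f : (Fin d → ℝ) → ℝ≥0) : ℝ≥0∞ :=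
  μ (A ∩ {t | 1 < f t})

lemma exceedanceVolume_mono (hAB : A ⊆ B) (f : (Fin d → ℝ) → ℝ≥0) :
    exceedanceVolume μ A f ≤ exceedanceVolume μ B f :=
  measure_mono (Set.inter_subset_inter_left _ hAB)

lemma exceedanceVolume_le_measure (f : (Fin d → ℝ) → ℝ≥0) : exceedanceVolume μ A f ≤ μ A :=
  measure_mono Set.inter_subset_left

lemma exceedanceVolume_comp_add_right {h : Fin d → ℝ} (hμ : MeasurePreserving (· + h) μ μ)
    (A : Set (Fin d → ℝ)) (f : (Fin d → ℝ) → ℝ≥0) :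
    exceedanceVolume μ ((· + h) ⁻¹' A) (fun t => f (t + h)) = exceedanceVolume μ A f :=
  hμ.measure_preimage_emb (measurableEmbedding_addRight h) (A ∩ {t | 1 < f t})

lemma tendsto_exceedanceVolume_iUnion {s : ℕ → Set (Fin d → ℝ)} (hs : Monotone s)
    (f : (Fin d → ℝ) → ℝ≥0) :
    Tendsto (fun n => exceedanceVolume μ (s n) f) atTop (𝓝 (exceedanceVolume μ (⋃ n, s n) f)) := by
  simp only [exceedanceVolume, Set.iUnion_inter]
  exact tendsto_measure_iUnion_atTop fun _ _ hmn => Set.inter_subset_inter_left _ (hs hmn)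

lemma measurable_exceedanceVolume_rightRegularization [SFinite μ] :
    Measurable fun f => exceedanceVolume μ A (rightRegularization f) := by
  have hs : MeasurableSet {p : ((Fin d → ℝ) → ℝ≥0) × (Fin d → ℝ) |
      1 < rightRegularization p.1 p.2} := measurable_rightRegularization measurableSet_Ioi
  have hrestrict (f : (Fin d → ℝ) → ℝ≥0) : exceedanceVolume μ A (rightRegularization f)
      = μ.restrict A {t | 1 < rightRegularization f t} := by
    rw [Measure.restrict_apply (t := {t | 1 < rightRegularization f t})
      (measurable_prodMk_left hs), Set.inter_comm, exceedanceVolume]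
  simp only [hrestrict]
  exact measurable_measure_prodMk_left hs

variable {α β : Type*} [MeasurableSpace α] [MeasurableSpace β] {m : Measure α} {m' : Measure β}
  {X : α → (Fin d → ℝ) → ℝ≥0} {X' : β → (Fin d → ℝ) → ℝ≥0}

lemma exceedanceVolume_rightRegularization_ae_eq (hc : ∀ᵐ a ∂m, IsRightCont (X a)) :
    (fun a => exceedanceVolume μ A (rightRegularization (X a)))
      =ᵐ[m] fun a => exceedanceVolume μ A (X a) := by
  filter_upwards [hc] with a ha
  rw [ha.rightRegularization_eq]

lemma aemeasurable_exceedanceVolume [SFinite μ] (hX : AEMeasurable X m)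
    (hc : ∀ᵐ a ∂m, IsRightCont (X a)) : AEMeasurable (fun a => exceedanceVolume μ A (X a)) m :=
  (measurable_exceedanceVolume_rightRegularization.comp_aemeasurable hX).congr
    (exceedanceVolume_rightRegularization_ae_eq hc)

lemma identDistrib_exceedanceVolume [SFinite μ]
    (h : IdentDistrib X X' m m') (hc : ∀ᵐ a ∂m, IsRightCont (X a))
    (hc' : ∀ᵐ b ∂m', IsRightCont (X' b)) :
    IdentDistrib (fun a => exceedanceVolume μ A (X a)) (fun b => exceedanceVolume μ A (X' b))
      m m' := by
  have hreg := h.comp (measurable_exceedanceVolume_rightRegularization (μ := μ) (A := A))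
  have hX : IdentDistrib (fun a => exceedanceVolume μ A (X a)) _ m m :=
    (IdentDistrib.of_ae_eq hreg.aemeasurable_fst
      (exceedanceVolume_rightRegularization_ae_eq hc)).symm
  exact (hX.trans hreg).trans <| IdentDistrib.of_ae_eq hreg.aemeasurable_snd
    (exceedanceVolume_rightRegularization_ae_eq hc')

lemma lintegral_mul_exceedanceVolume [SFinite m] [SFinite μ] (hX : Measurable X)
    (hc : ∀ᵐ a ∂m, IsRightCont (X a)) {g : α → ℝ≥0∞} (hg : AEMeasurable g m) :
    ∫⁻ a, g a * exceedanceVolume μ A (X a) ∂m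
      = ∫⁻ t in A, ∫⁻ a in {a | 1 < X a t}, g a ∂m ∂μ := by
  set E : Set (α × (Fin d → ℝ)) := {p | 1 < rightRegularization (X p.1) p.2}
  have hE : MeasurableSet E := (measurable_rightRegularization.comp
    ((hX.comp measurable_fst).prodMk measurable_snd)) measurableSet_Ioi
  calc ∫⁻ a, g a * exceedanceVolume μ A (X a) ∂m
      = ∫⁻ a, ∫⁻ t in A, E.indicator (fun p => g p.1) (a, t) ∂μ ∂m := by
        refine lintegral_congr_ae ?_
        filter_upwards [hc] with a ha
        have hEa : {t | (a, t) ∈ E} = {t | 1 < X a t} := by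
          simp only [E, Set.mem_ofPred_eq, ha.rightRegularization_eq]
        have hm : MeasurableSet {t | 1 < X a t} := hEa ▸ measurable_prodMk_left hE
        change _ = ∫⁻ t in A, {t | (a, t) ∈ E}.indicator (fun _ => g a) t ∂μ
        rw [hEa, lintegral_indicator_const hm, Measure.restrict_apply hm, Set.inter_comm,
          exceedanceVolume]
    _ = ∫⁻ t in A, ∫⁻ a, E.indicator (fun p => g p.1) (a, t) ∂m ∂μ :=
        lintegral_lintegral_swap (hg.comp_fst.indicator hE)
    _ = ∫⁻ t in A, ∫⁻ a in {a | 1 < X a t}, g a ∂m ∂μ := by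
        refine lintegral_congr fun t => ?_
        have hm : MeasurableSet {a | 1 < X a t} :=
          ((measurable_pi_apply t).comp hX) measurableSet_Ioi
        rw [← lintegral_indicator hm]
        refine lintegral_congr_ae ?_
        filter_upwards [hc] with a ha
        change {a | (a, t) ∈ E}.indicator g a = _
        simp only [E, Set.indicator_apply, Set.mem_ofPred_eq, ha.rightRegularization_eq]

end ExceedanceVolume

section GridMeasure

variable {d : ℕ}

instance sFinite_gridMeasure (δ : ℝ) : SFinite (gridMeasure d δ) := by
  unfold gridMeasure
  split_ifs <;> infer_instance

lemma measurePreserving_add_lattice (δ : ℝ) (k : Fin d → ℤ) :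
    MeasurePreserving (fun t : Fin d → ℝ => t + fun i => δ * k i)
      (Measure.sum fun l : Fin d → ℤ => Measure.dirac fun i => δ * (l i : ℝ))
      (Measure.sum fun l : Fin d → ℤ => Measure.dirac fun i => δ * (l i : ℝ)) := by
  have hm : Measurable (fun t : Fin d → ℝ => t + fun i => δ * k i) := measurable_add_const _
  refine ⟨hm, ?_⟩
  rw [Measure.map_sum hm.aemeasurable]
  conv_rhs => rw [← Measure.sum_comp_equiv (Equiv.addRight k)]
  congr 1
  funext l
  rw [Measure.map_dirac' hm]
  simp [Pi.add_def, mul_add]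

lemma ae_measurePreserving_gridMeasure (δ : ℝ) :
    ∀ᵐ t ∂(gridMeasure d δ), MeasurePreserving (· + t) (gridMeasure d δ) (gridMeasure d δ) := by
  unfold gridMeasure
  split_ifs
  · exact ae_of_all _ fun t => measurePreserving_add_right volume t
  · refine Measure.ae_smul_measure ?_ _
    rw [Measure.ae_sum_eq, Filter.eventually_iSup]
    intro k
    rw [ae_dirac_eq, eventually_pure]
    exact (measurePreserving_add_lattice δ k).smul_measure _

lemma gridMeasure_Icc {δ : ℝ} (hδ : 0 < δ) (a b : ℝ) :
    gridMeasure d δ (Set.Icc (fun _ => a) (fun _ => b))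
      = ENNReal.ofReal (δ * (Finset.Icc ⌈a / δ⌉ ⌊b / δ⌋).card) ^ d := by
  have hm : Measurable fun (k : Fin d → ℤ) (i : Fin d) => δ * (k i : ℝ) := measurable_of_countable _
  have hmap : Measure.sum (fun k : Fin d → ℤ => Measure.dirac fun i => δ * (k i : ℝ))
      = Measure.count.map fun (k : Fin d → ℤ) (i : Fin d) => δ * (k i : ℝ) := by
    rw [Measure.count, Measure.map_sum hm.aemeasurable]
    simp only [Measure.map_dirac' hm]
  have hlattice : (fun (k : Fin d → ℤ) (i : Fin d) => δ * (k i : ℝ)) ⁻¹'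
      Set.Icc (fun _ => a) (fun _ => b)
      = (Fintype.piFinset fun _ : Fin d => Finset.Icc ⌈a / δ⌉ ⌊b / δ⌋ : Finset (Fin d → ℤ)) := by
    ext k
    simp only [Set.mem_preimage, Set.mem_Icc, Pi.le_def, Finset.mem_coe, Fintype.mem_piFinset,
      Finset.mem_Icc, Int.ceil_le, Int.le_floor, div_le_iff₀ hδ, le_div_iff₀ hδ, ← forall_and,
      mul_comm δ]
  rw [gridMeasure, if_neg hδ.ne', hmap, Measure.smul_apply, Measure.map_apply hm measurableSet_Icc,
    hlattice, Measure.count_apply_finset, Fintype.card_piFinset_const, smul_eq_mul,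
    ENNReal.ofReal_mul hδ.le, ENNReal.ofReal_natCast, mul_pow, ENNReal.ofReal_pow hδ.le,
    Nat.cast_pow]

lemma abs_mul_card_Icc_ceil_floor_sub_le {δ a b : ℝ} (hδ : 0 < δ) (hab : a ≤ b) :
    |δ * (Finset.Icc ⌈a / δ⌉ ⌊b / δ⌋).card - (b - a)| ≤ δ := by
  have hle : ⌈a / δ⌉ ≤ ⌊b / δ⌋ + 1 := by
    rw [Int.ceil_le, Int.cast_add, Int.cast_one]
    exact (div_le_div_of_nonneg_right hab hδ.le).trans (Int.lt_floor_add_one _).le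
  have hcard : ((Finset.Icc ⌈a / δ⌉ ⌊b / δ⌋).card : ℝ) = ⌊b / δ⌋ + 1 - ⌈a / δ⌉ := by
    exact_mod_cast Int.card_Icc_of_le _ _ hle
  have hwidth : b - a = δ * (b / δ - a / δ) := by field_simp
  rw [hcard, hwidth, ← mul_sub, abs_mul, abs_of_pos hδ]
  refine mul_le_of_le_one_right hδ.le (abs_le.2 ⟨?_, ?_⟩) <;>
    linarith [Int.lt_floor_add_one (b / δ), Int.floor_le (b / δ), Int.le_ceil (a / δ),
      Int.ceil_lt_add_one (a / δ)]

lemma tendsto_div_self_of_abs_sub_le {g : ℝ → ℝ} {C : ℝ} (hg : ∀ᶠ T in atTop, |g T - T| ≤ C) :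
    Tendsto (fun T => g T / T) atTop (𝓝 1) := by
  rw [tendsto_iff_norm_sub_tendsto_zero]
  refine squeeze_zero' (Eventually.of_forall fun T => norm_nonneg _) ?_
    (tendsto_const_nhds.div_atTop tendsto_id : Tendsto (fun T => C / T) atTop (𝓝 0))
  filter_upwards [hg, eventually_gt_atTop 0] with T hT hpos
  rw [Real.norm_eq_abs, div_sub_one hpos.ne', abs_div, abs_of_pos hpos]
  gcongr

lemma tendsto_ofReal_pow_div {g : ℝ → ℝ} (hg : Tendsto (fun T => g T / T) atTop (𝓝 1)) :
    Tendsto (fun T => ENNReal.ofReal (g T) ^ d / ENNReal.ofReal (T ^ d)) atTop (𝓝 1) := by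
  have hlim := ENNReal.Tendsto.pow (n := d) (ENNReal.tendsto_ofReal hg)
  rw [ENNReal.ofReal_one, one_pow] at hlim
  refine hlim.congr' ?_
  filter_upwards [eventually_gt_atTop 0] with T hT
  rw [ENNReal.ofReal_div_of_pos hT, ENNReal.ofReal_pow hT.le, div_eq_mul_inv, mul_pow,
    div_eq_mul_inv, ENNReal.inv_pow]

lemma tendsto_gridMeasure_Icc_div {δ : ℝ} (hδ : 0 ≤ δ) (c : ℝ) :
    Tendsto (fun T : ℝ => gridMeasure d δ (Set.Icc (fun _ => c) (fun _ => T - c))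
      / ENNReal.ofReal (T ^ d)) atTop (𝓝 1) := by
  rcases hδ.eq_or_lt with rfl | hδ
  · have hside : ∀ᶠ T : ℝ in atTop, |T - c - c - T| ≤ |2 * c| :=
      Eventually.of_forall fun T => by rw [← abs_neg]; ring_nf; rfl
    simpa [gridMeasure, Real.volume_Icc_pi] using
      tendsto_ofReal_pow_div (d := d) (tendsto_div_self_of_abs_sub_le hside)
  · simp only [gridMeasure_Icc hδ]
    refine tendsto_ofReal_pow_div (tendsto_div_self_of_abs_sub_le (C := δ + |2 * c|) ?_)
    filter_upwards [eventually_ge_atTop (2 * c)] with T hT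
    have hcard := abs_mul_card_Icc_ceil_floor_sub_le hδ (show c ≤ T - c by linarith)
    rw [abs_le] at hcard ⊢
    constructor <;> linarith [neg_abs_le (2 * c), le_abs_self (2 * c)]

end GridMeasure

section TruncInv

/-- The function `y ↦ 1{y > x} / y` on `[0, ∞]`. If `S` is the sojourn time of the Pareto-tilted
field, then the Berman function at `x` is the mean of `truncInv x S`. -/
noncomputable def truncInv (x y : ℝ≥0∞) : ℝ≥0∞ := (Set.Ioi x).indicator (·⁻¹) y

variable {x y : ℝ≥0∞}

lemma measurable_truncInv (x : ℝ≥0∞) : Measurable (truncInv x) :=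
  measurable_inv.indicator measurableSet_Ioi

lemma truncInv_of_lt (h : x < y) : truncInv x y = y⁻¹ :=
  Set.indicator_of_mem (Set.mem_Ioi.2 h) _

lemma truncInv_of_le (h : y ≤ x) : truncInv x y = 0 :=
  Set.indicator_of_notMem (Set.notMem_Ioi.2 h) _

lemma truncInv_le_inv (x y : ℝ≥0∞) : truncInv x y ≤ x⁻¹ :=
  Set.indicator_apply_le' (fun h => ENNReal.inv_le_inv.2 (le_of_lt h)) fun _ => zero_le

lemma truncInv_mul_self (hy : y ≠ ∞) : truncInv x y * y = (Set.Ioi x).indicator 1 y := by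
  rcases lt_or_ge x y with h | h
  · rw [truncInv_of_lt h, Set.indicator_of_mem (Set.mem_Ioi.2 h),
      ENNReal.inv_mul_cancel (zero_le.trans_lt h).ne' hy, Pi.one_apply]
  · rw [truncInv_of_le h, Set.indicator_of_notMem (Set.notMem_Ioi.2 h), zero_mul]

lemma indicator_mul_inv_le_truncInv {l u : ℝ≥0∞} (hl : l ≤ y) (hu : y ≤ u) :
    (Set.Ioi x).indicator 1 l * u⁻¹ ≤ truncInv x y := by
  rcases lt_or_ge x l with h | h
  · rw [Set.indicator_of_mem (Set.mem_Ioi.2 h), Pi.one_apply, one_mul,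
      truncInv_of_lt (h.trans_le hl)]
    exact ENNReal.inv_le_inv.2 hu
  · rw [Set.indicator_of_notMem (Set.notMem_Ioi.2 h), zero_mul]
    exact zero_le

lemma truncInv_le_indicator_mul_inv_max {l u : ℝ≥0∞} (hl : l ≤ y) (hu : y ≤ u) :
    truncInv x y ≤ (Set.Ioi x).indicator 1 u * (max l x)⁻¹ := by
  rcases lt_or_ge x y with h | h
  · rw [Set.indicator_of_mem (Set.mem_Ioi.2 (h.trans_le hu)), Pi.one_apply, one_mul,
      truncInv_of_lt h]
    exact ENNReal.inv_le_inv.2 (max_le hl h.le)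
  · rw [truncInv_of_le h]
    exact zero_le

lemma tendsto_indicator_mul_inv {s : ℕ → ℝ≥0∞} (hs : Tendsto s atTop (𝓝 y)) (hle : ∀ n, s n ≤ y) :
    Tendsto (fun n => (Set.Ioi x).indicator 1 (s n) * y⁻¹) atTop (𝓝 (truncInv x y)) := by
  refine tendsto_const_nhds.congr' ?_
  rcases lt_or_ge x y with h | h
  · filter_upwards [hs.eventually_const_lt h] with n hn
    rw [truncInv_of_lt h, Set.indicator_of_mem (Set.mem_Ioi.2 hn), Pi.one_apply, one_mul]
  · refine Eventually.of_forall fun n => ?_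
    simp only [truncInv_of_le h, zero_mul,
      Set.indicator_of_notMem (Set.notMem_Ioi.2 ((hle n).trans h))]

lemma tendsto_indicator_mul_inv_max {s : ℕ → ℝ≥0∞} (hs : Tendsto s atTop (𝓝 y)) :
    Tendsto (fun n => (Set.Ioi x).indicator 1 y * (max (s n) x)⁻¹) atTop
      (𝓝 (truncInv x y)) := by
  rcases lt_or_ge x y with h | h
  · simp only [truncInv_of_lt h, Set.indicator_of_mem (Set.mem_Ioi.2 h), Pi.one_apply, one_mul]
    simpa only [max_eq_left h.le] using (hs.max (tendsto_const_nhds (x := x))).inv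
  · simp only [truncInv_of_le h, Set.indicator_of_notMem (Set.notMem_Ioi.2 h), zero_mul,
      tendsto_const_nhds_iff]

variable {α : Type*} [MeasurableSpace α] {Q : Measure α} {S : α → ℝ≥0∞}

lemma tendsto_lintegral_indicator_mul_inv [IsFiniteMeasure Q] (hx : x ≠ 0) {s : ℕ → α → ℝ≥0∞}
    (hs : ∀ n, AEMeasurable (s n) Q) (hS : AEMeasurable S Q) (hle : ∀ n a, s n a ≤ S a)
    (hlim : ∀ a, Tendsto (s · a) atTop (𝓝 (S a))) :
    Tendsto (fun n => ∫⁻ a, (Set.Ioi x).indicator 1 (s n a) * (S a)⁻¹ ∂Q) atTop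
      (𝓝 (∫⁻ a, truncInv x (S a) ∂Q)) := by
  refine tendsto_lintegral_of_dominated_convergence' (fun _ => x⁻¹) (fun n => ?_)
    (fun n => ae_of_all _ fun a => ?_) ?_
    (ae_of_all _ fun a => tendsto_indicator_mul_inv (hlim a) (hle · a))
  · exact ((measurable_one.indicator measurableSet_Ioi).comp_aemeasurable (hs n)).mul hS.inv
  · exact (indicator_mul_inv_le_truncInv (hle n a) le_rfl).trans (truncInv_le_inv _ _)
  · simpa using ENNReal.mul_ne_top (ENNReal.inv_ne_top.2 hx) (measure_ne_top Q _)

lemma tendsto_lintegral_indicator_mul_inv_max [IsFiniteMeasure Q] (hx : x ≠ 0)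
    {s : ℕ → α → ℝ≥0∞} (hs : ∀ n, AEMeasurable (s n) Q) (hS : AEMeasurable S Q)
    (hlim : ∀ a, Tendsto (s · a) atTop (𝓝 (S a))) :
    Tendsto (fun n => ∫⁻ a, (Set.Ioi x).indicator 1 (S a) * (max (s n a) x)⁻¹ ∂Q) atTop
      (𝓝 (∫⁻ a, truncInv x (S a) ∂Q)) := by
  refine tendsto_lintegral_of_dominated_convergence' (fun _ => x⁻¹) (fun n => ?_)
    (fun n => ae_of_all _ fun a => ?_) ?_
    (ae_of_all _ fun a => tendsto_indicator_mul_inv_max (hlim a))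
  · exact ((measurable_one.indicator measurableSet_Ioi).comp_aemeasurable hS).mul
      ((hs n).max aemeasurable_const).inv
  · exact mul_le_of_le_one_of_le (Set.indicator_le_self' (fun _ _ => zero_le) _)
      (ENNReal.inv_le_inv.2 (le_max_right _ _))
  · simpa using ENNReal.mul_ne_top (ENNReal.inv_ne_top.2 hx) (measure_ne_top Q _)

lemma lintegral_truncInv_le (hS : AEMeasurable S Q) (x : ℝ≥0∞) :
    ∫⁻ a, truncInv x (S a) ∂Q ≤ x⁻¹ * Q {a | x ≤ S a} := by
  rw [← lintegral_indicator_const₀ (nullMeasurableSet_le aemeasurable_const hS)]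
  refine lintegral_mono fun a => ?_
  rcases lt_or_ge x (S a) with h | h
  · rw [Set.indicator_of_mem (show a ∈ {a | x ≤ S a} from h.le)]
    exact truncInv_le_inv _ _
  · rw [truncInv_of_le h]
    exact zero_le

lemma sq_lintegral_rpow_half_mul_le {f g : α → ℝ≥0∞} (hf : AEMeasurable f Q)
    (hg : AEMeasurable g Q) :
    (∫⁻ a, f a ^ (1 / 2 : ℝ) * g a ^ (1 / 2 : ℝ) ∂Q) ^ 2 ≤ (∫⁻ a, f a ∂Q) * ∫⁻ a, g a ∂Q := by
  have hsq (z : ℝ≥0∞) : (z ^ (1 / 2 : ℝ)) ^ 2 = z := by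
    rw [← ENNReal.rpow_two, ← ENNReal.rpow_mul]
    norm_num
  have hCS := ENNReal.lintegral_mul_le_Lp_mul_Lq Q Real.HolderConjugate.two_two
    (hf.pow_const (1 / 2 : ℝ)) (hg.pow_const (1 / 2 : ℝ))
  simp only [ENNReal.rpow_two, hsq, Pi.mul_apply] at hCS
  simpa only [mul_pow, hsq] using pow_le_pow_left' hCS 2

lemma sq_measure_lt_div_lintegral_le (hS : AEMeasurable S Q) (x : ℝ≥0∞) :
    Q {a | x < S a} ^ 2 / ∫⁻ a, S a ∂Q ≤ ∫⁻ a, truncInv x (S a) ∂Q := by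
  by_cases hfin : ∫⁻ a, S a ∂Q = ∞
  · rw [hfin, ENNReal.div_top]
    exact zero_le
  have hprob : Q {a | x < S a} = ∫⁻ a, truncInv x (S a) ^ (1 / 2 : ℝ) * S a ^ (1 / 2 : ℝ) ∂Q := by
    rw [← lintegral_indicator_one₀ (nullMeasurableSet_lt aemeasurable_const hS)]
    refine lintegral_congr_ae ?_
    filter_upwards [ae_lt_top' hS hfin] with a ha
    rw [← ENNReal.mul_rpow_of_nonneg _ _ (by norm_num), truncInv_mul_self ha.ne]
    simp only [Set.indicator_apply, Set.mem_ofPred_eq, Set.mem_Ioi, Pi.one_apply]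
    split_ifs <;> simp
  rw [hprob]
  exact ENNReal.div_le_of_le_mul
    (sq_lintegral_rpow_half_mul_le ((measurable_truncInv x).comp_aemeasurable hS) hS)

end TruncInv

section CubeAverages

variable {d : ℕ} {μ : Measure (Fin d → ℝ)}

lemma cube_eq_Icc (d : ℕ) (T : ℝ) : cube d T = Set.Icc (fun _ => 0) (fun _ => T - 0) := by
  rw [sub_zero]
  rfl

/-- The cubes `[c, T - c]^d` fill `[0, T]^d` asymptotically, whose volume is asymptotic to `T^d`. -/
def IsCubeNormalized (μ : Measure (Fin d → ℝ)) : Prop :=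
  ∀ c : ℝ, Tendsto (fun T : ℝ => μ (Set.Icc (fun _ => c) (fun _ => T - c)) / ENNReal.ofReal (T ^ d))
    atTop (𝓝 1)

namespace IsCubeNormalized

lemma eventually_measure_ne_top (hμ : IsCubeNormalized μ) (c : ℝ) :
    ∀ᶠ T : ℝ in atTop, μ (Set.Icc (fun _ => c) (fun _ => T - c)) ≠ ∞ := by
  filter_upwards [(hμ c).eventually_lt_const ENNReal.one_lt_top] with T hT htop
  rw [htop, ENNReal.top_div_of_ne_top ENNReal.ofReal_ne_top] at hT
  exact lt_irrefl _ hT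

lemma tendsto_measure_cube_diff (hμ : IsCubeNormalized μ) {c : ℝ} (hc : 0 ≤ c) :
    Tendsto (fun T : ℝ => μ (cube d T \ Set.Icc (fun _ => c) (fun _ => T - c))
      / ENNReal.ofReal (T ^ d)) atTop (𝓝 0) := by
  have hdiff := ENNReal.Tendsto.sub (hμ 0) (hμ c) (Or.inl ENNReal.one_ne_top)
  rw [tsub_self] at hdiff
  refine hdiff.congr' ?_
  filter_upwards [hμ.eventually_measure_ne_top c, eventually_gt_atTop 0] with T hfin hT
  have hsub : Set.Icc (fun _ : Fin d => c) (fun _ => T - c) ⊆ cube d T :=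
    Set.Icc_subset_Icc (fun _ => hc) fun _ => by simpa using hc
  rw [measure_sdiff hsub measurableSet_Icc.nullMeasurableSet hfin, ← cube_eq_Icc,
    ENNReal.sub_div fun _ _ => (ENNReal.ofReal_pos.2 (by positivity)).ne']

variable {φ : ℝ → (Fin d → ℝ) → ℝ≥0∞}

lemma le_liminf_setLIntegral_cube_div (hμ : IsCubeNormalized μ) {c : ℝ} (hc : 0 ≤ c) {a : ℝ≥0∞}
    (ha : ∀ T, ∀ t ∈ Set.Icc (fun _ => c) (fun _ => T - c), a ≤ φ T t) :
    a ≤ liminf (fun T => (∫⁻ t in cube d T, φ T t ∂μ) / ENNReal.ofReal (T ^ d)) atTop := by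
  have hlim := ENNReal.Tendsto.const_mul (a := a) (hμ c) (Or.inl one_ne_zero)
  rw [mul_one] at hlim
  rw [← hlim.liminf_eq]
  refine liminf_le_liminf (Eventually.of_forall fun T => ?_)
  have hsub : Set.Icc (fun _ : Fin d => c) (fun _ => T - c) ⊆ cube d T :=
    Set.Icc_subset_Icc (fun _ => hc) fun _ => by simpa using hc
  rw [← mul_div_assoc, ← setLIntegral_const]
  exact ENNReal.div_le_div_right
    ((setLIntegral_mono' measurableSet_Icc (ha T)).trans (lintegral_mono_set hsub)) _

lemma limsup_setLIntegral_cube_div_le (hμ : IsCubeNormalized μ) {c : ℝ} (hc : 0 ≤ c)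
    {b C : ℝ≥0∞} (hC : C ≠ ∞) (hφ : ∀ T t, φ T t ≤ C)
    (hb : ∀ T, ∀ t ∈ Set.Icc (fun _ => c) (fun _ => T - c), φ T t ≤ b) :
    limsup (fun T => (∫⁻ t in cube d T, φ T t ∂μ) / ENNReal.ofReal (T ^ d)) atTop ≤ b := by
  have hlim := (ENNReal.Tendsto.const_mul (a := b) (hμ c) (Or.inl one_ne_zero)).add
    (ENNReal.Tendsto.const_mul (hμ.tendsto_measure_cube_diff hc) (Or.inr hC))
  rw [mul_one, mul_zero, add_zero] at hlim
  rw [← hlim.limsup_eq]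
  refine limsup_le_limsup (Eventually.of_forall fun T => ?_)
  simp only [← mul_div_assoc, ← ENNReal.add_div]
  refine ENNReal.div_le_div_right ?_ _
  rw [← lintegral_inter_add_sdiff _ (cube d T)
      (measurableSet_Icc (a := fun _ : Fin d => c) (b := fun _ => T - c)),
    ← setLIntegral_const, ← setLIntegral_const]
  exact add_le_add ((lintegral_mono_set Set.inter_subset_right).trans
    (setLIntegral_mono' measurableSet_Icc (hb T))) (lintegral_mono fun t => hφ T t)

lemma tendsto_setLIntegral_cube_div (hμ : IsCubeNormalized μ) {a b : ℕ → ℝ≥0∞} {B C : ℝ≥0∞}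
    (ha : Tendsto a atTop (𝓝 B)) (hb : Tendsto b atTop (𝓝 B)) (hC : C ≠ ∞) (hφ : ∀ T t, φ T t ≤ C)
    (haφ : ∀ (n : ℕ) T, ∀ t ∈ Set.Icc (fun _ => (n : ℝ)) (fun _ => T - n), a n ≤ φ T t)
    (hφb : ∀ (n : ℕ) T, ∀ t ∈ Set.Icc (fun _ => (n : ℝ)) (fun _ => T - n), φ T t ≤ b n) :
    Tendsto (fun T => (∫⁻ t in cube d T, φ T t ∂μ) / ENNReal.ofReal (T ^ d)) atTop (𝓝 B) :=
  tendsto_of_le_liminf_of_limsup_le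
    (le_of_tendsto' ha fun n => hμ.le_liminf_setLIntegral_cube_div n.cast_nonneg (haφ n))
    (ge_of_tendsto' hb fun n =>
      hμ.limsup_setLIntegral_cube_div_le n.cast_nonneg hC hφ (hφb n))

end IsCubeNormalized

lemma isCubeNormalized_gridMeasure {δ : ℝ} (hδ : 0 ≤ δ) : IsCubeNormalized (gridMeasure d δ) :=
  tendsto_gridMeasure_Icc_div hδ

end CubeAverages

section StationaryExceedances

variable {d : ℕ} {α : Type*} [MeasurableSpace α] {m : Measure α} {X : α → (Fin d → ℝ) → ℝ≥0}

/-- Seen from a point where it exceeds the level one, the field has the same (possibly infinite)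
distribution wherever this point lies. -/
def HasStationaryExceedances (m : Measure α) (X : α → (Fin d → ℝ) → ℝ≥0) : Prop :=
  ∀ t, IdentDistrib (fun a s => X a (s + t)) X (m.restrict {a | 1 < X a t})
    (m.restrict {a | 1 < X a 0})

variable {μ : Measure (Fin d → ℝ)} [SFinite μ]

lemma HasStationaryExceedances.lintegral_exceedanceVolume (hst : HasStationaryExceedances m X)
    (hc : ∀ᵐ a ∂m, IsRightCont (X a)) {t : Fin d → ℝ} (ht : MeasurePreserving (· + t) μ μ)
    (A : Set (Fin d → ℝ)) {g : ℝ≥0∞ → ℝ≥0∞} (hg : Measurable g) :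
    ∫⁻ a in {a | 1 < X a t}, g (exceedanceVolume μ A (X a)) ∂m
      = ∫⁻ a in {a | 1 < X a 0}, g (exceedanceVolume μ ((· + t) ⁻¹' A) (X a)) ∂m := by
  have hident := (identDistrib_exceedanceVolume (μ := μ) (A := (· + t) ⁻¹' A) (hst t)
    (ae_restrict_of_ae (hc.mono fun a ha => ha.comp_add_right t)) (ae_restrict_of_ae hc)).comp hg
  simpa only [Function.comp_def, exceedanceVolume_comp_add_right ht] using hident.lintegral_eq

/-- Both sides are the mean of `truncInv x S * S` for `S = exceedanceVolume μ A X`: one factor `S`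
is written as an integral over the positions of the exceedances, which are then shifted to `0`. -/
lemma HasStationaryExceedances.measure_lt_exceedanceVolume [SFinite m] {A : Set (Fin d → ℝ)}
    (hst : HasStationaryExceedances m X) (hX : Measurable X) (hc : ∀ᵐ a ∂m, IsRightCont (X a))
    (hμ : ∀ᵐ t ∂μ, MeasurePreserving (· + t) μ μ) (hA : μ A ≠ ∞) (x : ℝ≥0∞) :
    m {a | x < exceedanceVolume μ A (X a)}
      = ∫⁻ t in A, ∫⁻ a in {a | 1 < X a 0},
          truncInv x (exceedanceVolume μ ((· + t) ⁻¹' A) (X a)) ∂m ∂μ := by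
  have hS : AEMeasurable (fun a => exceedanceVolume μ A (X a)) m :=
    aemeasurable_exceedanceVolume hX.aemeasurable hc
  calc m {a | x < exceedanceVolume μ A (X a)}
      = ∫⁻ a, truncInv x (exceedanceVolume μ A (X a)) * exceedanceVolume μ A (X a) ∂m := by
        rw [← lintegral_indicator_one₀ (nullMeasurableSet_lt aemeasurable_const hS)]
        refine lintegral_congr fun a => ?_
        rw [truncInv_mul_self (ne_top_of_le_ne_top hA (exceedanceVolume_le_measure _))]
        rfl
    _ = ∫⁻ t in A, ∫⁻ a in {a | 1 < X a t}, truncInv x (exceedanceVolume μ A (X a)) ∂m ∂μ :=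
        lintegral_mul_exceedanceVolume hX hc ((measurable_truncInv x).comp_aemeasurable hS)
    _ = _ := by
        refine lintegral_congr_ae ?_
        filter_upwards [ae_restrict_of_ae hμ] with t ht
        exact hst.lintegral_exceedanceVolume hc ht A (measurable_truncInv x)

lemma iUnion_Icc_neg_natCast (d : ℕ) :
    ⋃ n : ℕ, Set.Icc (fun _ : Fin d => -(n : ℝ)) (fun _ => n) = Set.univ := by
  refine Set.eq_univ_of_forall fun t => ?_
  obtain ⟨n, hn⟩ := exists_nat_ge ‖t‖
  refine Set.mem_iUnion.2 ⟨n, ?_, ?_⟩ <;> intro i <;>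
    linarith [abs_le.1 ((norm_le_pi_norm t i).trans hn)]

lemma monotone_Icc_neg_natCast (d : ℕ) :
    Monotone fun n : ℕ => Set.Icc (fun _ : Fin d => -(n : ℝ)) (fun _ => n) := by
  intro m n hmn
  have hle : (m : ℝ) ≤ n := Nat.cast_le.2 hmn
  exact Set.Icc_subset_Icc (fun _ => neg_le_neg hle) fun _ => hle

lemma Icc_neg_subset_preimage_cube {c T : ℝ} {t : Fin d → ℝ}
    (ht : t ∈ Set.Icc (fun _ => c) (fun _ => T - c)) :
    Set.Icc (fun _ => -c) (fun _ => c) ⊆ (· + t) ⁻¹' cube d T := by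
  intro s hs
  refine ⟨fun i => ?_, fun i => ?_⟩
  · have := hs.1 i
    have := ht.1 i
    simp only [Pi.zero_apply, Pi.add_apply]
    linarith
  · have := hs.2 i
    have := ht.2 i
    simp only [Pi.add_apply]
    linarith

lemma HasStationaryExceedances.tendsto_measure_lt_exceedanceVolume_div [SFinite m]
    (hst : HasStationaryExceedances m X) (hX : Measurable X) (hc : ∀ᵐ a ∂m, IsRightCont (X a))
    (hfin : m {a | 1 < X a 0} ≠ ∞) (hμ : ∀ᵐ t ∂μ, MeasurePreserving (· + t) μ μ)
    (hcube : IsCubeNormalized μ) {x : ℝ≥0∞} (hx : x ≠ 0) :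
    Tendsto (fun T => m {a | x < exceedanceVolume μ (cube d T) (X a)} / ENNReal.ofReal (T ^ d))
      atTop (𝓝 (∫⁻ a in {a | 1 < X a 0}, truncInv x (exceedanceVolume μ Set.univ (X a)) ∂m)) := by
  have : IsFiniteMeasure (m.restrict {a | 1 < X a 0}) := isFiniteMeasure_restrict.2 hfin
  have hS (A : Set (Fin d → ℝ)) :
      AEMeasurable (fun a => exceedanceVolume μ A (X a)) (m.restrict {a | 1 < X a 0}) :=
    aemeasurable_exceedanceVolume hX.aemeasurable (ae_restrict_of_ae hc)
  have hlim (a : α) := tendsto_exceedanceVolume_iUnion (μ := μ) (monotone_Icc_neg_natCast d) (X a)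
  simp only [iUnion_Icc_neg_natCast] at hlim
  have hinner {c T : ℝ} {t : Fin d → ℝ} (ht : t ∈ Set.Icc (fun _ => c) (fun _ => T - c)) (a : α) :=
    exceedanceVolume_mono (μ := μ) (Icc_neg_subset_preimage_cube ht) (X a)
  have houter (A : Set (Fin d → ℝ)) (a : α) :=
    exceedanceVolume_mono (μ := μ) (Set.subset_univ A) (X a)
  refine (hcube.tendsto_setLIntegral_cube_div
    (tendsto_lintegral_indicator_mul_inv hx (fun n => hS _) (hS _) (fun n => houter _) hlim)
    (tendsto_lintegral_indicator_mul_inv_max hx (fun n => hS _) (hS _) hlim)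
    (ENNReal.mul_ne_top (ENNReal.inv_ne_top.2 hx) hfin)
    (fun T t => (lintegral_mono fun a => truncInv_le_inv x _).trans (by simp))
    (fun n T t ht => lintegral_mono fun a =>
      indicator_mul_inv_le_truncInv (hinner ht a) (houter _ a))
    (fun n T t ht => lintegral_mono fun a =>
      truncInv_le_indicator_mul_inv_max (hinner ht a) (houter _ a))).congr' ?_
  filter_upwards [hcube.eventually_measure_ne_top 0] with T hT
  rw [← cube_eq_Icc] at hT
  rw [hst.measure_lt_exceedanceVolume hX hc hμ hT]

end StationaryExceedances

section VoidProbability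

lemma integral_Ioi_of_hasDerivWithinAt_of_tendsto {f f' : ℝ → ℝ} {a m : ℝ} (hf : Continuous f)
    (hderiv : ∀ x ∈ Set.Ioi a, HasDerivWithinAt f (f' x) (Set.Ioi x) x)
    (hf' : IntegrableOn f' (Set.Ioi a)) (hlim : Tendsto f atTop (𝓝 m)) :
    ∫ x in Set.Ioi a, f' x = m - f a := by
  refine tendsto_nhds_unique (intervalIntegral_tendsto_integral_Ioi a hf' tendsto_id)
    ((hlim.sub_const (f a)).congr' ?_)
  filter_upwards [eventually_ge_atTop a] with b hb
  refine (intervalIntegral.integral_eq_sub_of_hasDeriv_right hf.continuousOn (fun x hx => ?_)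
    ((intervalIntegrable_iff_integrableOn_Ioc_of_le hb).2
      (hf'.mono_set Set.Ioc_subset_Ioi_self))).symm
  rw [min_eq_left hb] at hx
  exact hderiv x hx.1

lemma lintegral_one_sub_cdf (κ : Measure ℝ) [IsProbabilityMeasure κ] :
    ∫⁻ s in Set.Ioi 0, ENNReal.ofReal (1 - cdf κ s) = ∫⁻ x, ENNReal.ofReal x ∂κ := by
  have hcake := lintegral_eq_lintegral_meas_lt κ (f := fun x => max x 0)
    (ae_of_all _ fun x => le_max_right x 0) (by fun_prop)
  simp only [ENNReal.ofReal_max, ENNReal.ofReal_zero, max_eq_left zero_le] at hcake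
  rw [hcake]
  refine setLIntegral_congr_fun measurableSet_Ioi fun s hs => ?_
  have hexceed : {x : ℝ | s < max x 0} = (Set.Iic s)ᶜ := by
    ext x
    simp [not_lt.2 (Set.mem_Ioi.1 hs).le]
  simp only [hexceed, prob_compl_eq_one_sub measurableSet_Iic, ← ofReal_cdf,
    ENNReal.ofReal_sub 1 (cdf_nonneg κ s), ENNReal.ofReal_one]

lemma integrableOn_one_sub_cdf {κ : Measure ℝ} [IsProbabilityMeasure κ] (hκ : Integrable id κ)
    (u : ℝ) : IntegrableOn (fun s => 1 - cdf κ s) (Set.Ioi u) := by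
  have hmono : Antitone fun s => 1 - cdf κ s :=
    fun s t hst => sub_le_sub_left (monotone_cdf κ hst) 1
  have htail : IntegrableOn (fun s => 1 - cdf κ s) (Set.Ioi 0) := by
    refine ⟨hmono.measurable.aestronglyMeasurable, ?_⟩
    rw [hasFiniteIntegral_iff_ofReal (ae_of_all _ fun s => sub_nonneg.2 (cdf_le_one κ s)),
      lintegral_one_sub_cdf]
    exact hκ.lintegral_lt_top
  refine ((hmono.locallyIntegrable.integrableOn_isCompact
    (isCompact_Icc (a := u) (b := 0))).union htail).mono_set fun s hs => ?_
  rcases le_or_gt s 0 with h | h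
  exacts [Or.inl ⟨(Set.mem_Ioi.1 hs).le, h⟩, Or.inr h]

/-- For a unit rate Poisson process on the half-line whose points carry independent marks with law
`κ`, the probability that no point `s > u` is exceeded by its mark. -/
noncomputable def voidProb (κ : Measure ℝ) (u : ℝ) : ℝ :=
  Real.exp (-∫ s in Set.Ioi u, (1 - cdf κ s))

lemma voidProb_pos (κ : Measure ℝ) (u : ℝ) : 0 < voidProb κ u := Real.exp_pos _

lemma voidProb_le_one (κ : Measure ℝ) (u : ℝ) : voidProb κ u ≤ 1 :=
  Real.exp_le_one_iff.2 (neg_nonpos.2 (integral_nonneg fun s => sub_nonneg.2 (cdf_le_one κ s)))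

lemma voidProb_zero {κ : Measure ℝ} [IsProbabilityMeasure κ] (hκ : Integrable id κ) :
    voidProb κ 0 = Real.exp (-(∫⁻ x, ENNReal.ofReal x ∂κ).toReal) := by
  rw [voidProb, integral_eq_lintegral_of_nonneg_ae
    (ae_of_all _ fun s => sub_nonneg.2 (cdf_le_one κ s))
    (integrableOn_one_sub_cdf hκ 0).aestronglyMeasurable, lintegral_one_sub_cdf]

lemma tendsto_voidProb_atTop (κ : Measure ℝ) : Tendsto (voidProb κ) atTop (𝓝 1) := by
  have hlim := (tendsto_integral_Ioi_zero (f := fun s => 1 - cdf κ s) (μ := volume)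
    tendsto_id).neg.rexp
  rwa [neg_zero, Real.exp_zero] at hlim

lemma lintegral_expMeasure_one (f : ℝ → ℝ≥0∞) :
    ∫⁻ v, f v ∂expMeasure 1 = ∫⁻ v in Set.Ioi 0, ENNReal.ofReal (Real.exp (-v)) * f v := by
  have hpdf : Measurable (gammaPDF 1 1) := (measurable_gammaPDFReal 1 1).ennreal_ofReal
  rw [expMeasure, gammaMeasure, lintegral_withDensity_eq_lintegral_mul_non_measurable₀ _
    hpdf.aemeasurable (ae_of_all _ fun v => ENNReal.ofReal_lt_top),
    setLIntegral_congr Ioi_ae_eq_Ici, ← lintegral_indicator measurableSet_Ici]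
  refine lintegral_congr fun v => ?_
  by_cases hv : 0 ≤ v <;> simp [hv, gammaPDF, gammaPDFReal]

section Integrable

variable {κ : Measure ℝ} [IsProbabilityMeasure κ] (hκ : Integrable id κ)
include hκ

lemma hasDerivWithinAt_voidProb (u : ℝ) :
    HasDerivWithinAt (voidProb κ) (voidProb κ u * (1 - cdf κ u)) (Set.Ici u) u := by
  have hprimitive : HasDerivWithinAt (fun b => ∫ s in (0 : ℝ)..b, (1 - cdf κ s)) (1 - cdf κ u)
      (Set.Ici u) u :=
    intervalIntegral.integral_hasDerivWithinAt_right (t := Set.Ioi u)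
      (intervalIntegrable_const.sub (monotone_cdf κ).intervalIntegrable)
      ((monotone_cdf κ).measurable.const_sub 1).stronglyMeasurable.stronglyMeasurableAtFilter
      (continuousWithinAt_const.sub
        (((cdf κ).right_continuous u).mono Set.Ioi_subset_Ici_self))
  have hvoid : voidProb κ = fun b => Real.exp
      (-((∫ s in Set.Ioi 0, (1 - cdf κ s)) - ∫ s in (0 : ℝ)..b, (1 - cdf κ s))) := by
    funext b
    rw [voidProb, ← intervalIntegral.integral_Ioi_sub_Ioi' (integrableOn_one_sub_cdf hκ 0)
      (integrableOn_one_sub_cdf hκ b), sub_sub_cancel]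
  have hderiv := (hprimitive.const_sub (∫ s in Set.Ioi 0, (1 - cdf κ s))).neg.exp
  rw [neg_neg] at hderiv
  rwa [hvoid]

lemma continuous_voidProb : Continuous (voidProb κ) := by
  refine Real.continuous_exp.comp (continuous_iff_continuousAt.2 fun u => ?_).neg
  exact (integrableOn_one_sub_cdf hκ (u - 1)).continuousOn_Ici_primitive_Ioi.continuousAt
    (Ici_mem_nhds (sub_one_lt u))

lemma hasDerivWithinAt_exp_neg_mul_voidProb (u v : ℝ) :
    HasDerivWithinAt (fun v => -(Real.exp (-v) * voidProb κ (u + v)))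
      (Real.exp (-v) * (cdf κ (u + v) * voidProb κ (u + v))) (Set.Ioi v) v := by
  have hexp : HasDerivWithinAt (fun v => Real.exp (-v)) (-Real.exp (-v)) (Set.Ioi v) v := by
    simpa using ((hasDerivAt_id v).neg.exp).hasDerivWithinAt
  have hvoid : HasDerivWithinAt (fun v => voidProb κ (u + v))
      (voidProb κ (u + v) * (1 - cdf κ (u + v)) * 1) (Set.Ioi v) v :=
    (hasDerivWithinAt_voidProb hκ (u + v)).comp v
      ((hasDerivAt_id v).const_add u).hasDerivWithinAt
      fun w hw => by simpa using (Set.mem_Ioi.1 hw).le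
  refine (hexp.mul hvoid).neg.congr_deriv ?_
  ring

lemma lintegral_cdf_mul_voidProb (u : ℝ) :
    ∫⁻ v, ENNReal.ofReal (cdf κ (u + v)) * ENNReal.ofReal (voidProb κ (u + v)) ∂expMeasure 1
      = ENNReal.ofReal (voidProb κ u) := by
  have hcont := continuous_voidProb hκ
  have hcdf : Measurable (cdf κ) := (monotone_cdf κ).measurable
  let f : ℝ → ℝ := fun v => -(Real.exp (-v) * voidProb κ (u + v))
  let f' : ℝ → ℝ := fun v => Real.exp (-v) * (cdf κ (u + v) * voidProb κ (u + v))
  have hf'_nonneg (v : ℝ) : 0 ≤ f' v :=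
    mul_nonneg (Real.exp_pos _).le (mul_nonneg (cdf_nonneg κ _) (voidProb_pos κ _).le)
  have hf'_int : IntegrableOn f' (Set.Ioi 0) := by
    refine Integrable.mono' (integrableOn_exp_neg_Ioi 0)
      (Measurable.aestronglyMeasurable (by fun_prop)) (ae_of_all _ fun v => ?_)
    rw [Real.norm_of_nonneg (hf'_nonneg v)]
    exact mul_le_of_le_one_right (Real.exp_pos _).le
      (mul_le_one₀ (cdf_le_one κ _) (voidProb_pos κ _).le (voidProb_le_one κ _))
  have hlim : Tendsto f atTop (𝓝 0) := by
    have := (squeeze_zero (fun v => (mul_pos (Real.exp_pos _) (voidProb_pos κ (u + v))).le)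
      (fun v => mul_le_of_le_one_right (Real.exp_pos _).le (voidProb_le_one κ (u + v)))
      Real.tendsto_exp_neg_atTop_nhds_zero).neg
    simpa only [neg_zero] using this
  have hint : ∫ v in Set.Ioi 0, f' v = voidProb κ u := by
    rw [integral_Ioi_of_hasDerivWithinAt_of_tendsto (by fun_prop)
      (fun v _ => hasDerivWithinAt_exp_neg_mul_voidProb hκ u v) hf'_int hlim]
    simp
  rw [lintegral_expMeasure_one, ← hint,
    ofReal_integral_eq_lintegral_ofReal hf'_int (ae_of_all _ hf'_nonneg)]
  simp only [f', ENNReal.ofReal_mul (Real.exp_pos _).le, ENNReal.ofReal_mul (cdf_nonneg κ _)]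

end Integrable

end VoidProbability

lemma lintegral_comp_prodMk_of_indepFun {Ω α β : Type*} [MeasurableSpace Ω] [MeasurableSpace α]
    [MeasurableSpace β] {P : Measure Ω} [IsFiniteMeasure P] {X : Ω → α} {Y : Ω → β}
    (hXY : IndepFun X Y P) (hX : Measurable X) (hY : Measurable Y) {f : α × β → ℝ≥0∞}
    (hf : Measurable f) :
    ∫⁻ ω, f (X ω, Y ω) ∂P = ∫⁻ ω, ∫⁻ y, f (X ω, y) ∂P.map Y ∂P := by
  rw [← lintegral_map hf (hX.prodMk hY), hXY.map_prod_eq_prod_map_map hX.aemeasurable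
    hY.aemeasurable, lintegral_prod _ hf.aemeasurable, lintegral_map hf.lintegral_prod_right' hX]

lemma indepFun_of_dependsOn_Iio {Ω α : Type*} [MeasurableSpace Ω] [MeasurableSpace α]
    {P : Measure Ω} {V : ℕ → Ω → ℝ} (hV : iIndepFun V P) (hVm : ∀ k, Measurable (V k)) {n : ℕ}
    {φ : (ℕ → ℝ) → α} (hφ : Measurable φ) (hdep : DependsOn φ (Set.Iio n)) :
    IndepFun (fun ω => φ fun k => V k ω) (V n) P := by
  let extend (y : Finset.range n → ℝ) (k : ℕ) : ℝ :=
    if hk : k ∈ Finset.range n then y ⟨k, hk⟩ else 0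
  have hextend : Measurable extend := measurable_pi_lambda _ fun k => by
    by_cases hk : k ∈ Finset.range n
    · simpa only [extend, hk, dif_pos] using measurable_pi_apply _
    · simp only [extend, hk, dif_neg, not_false_eq_true, measurable_const]
  have h := (hV.indepFun_finset (Finset.range n) {n} (by simp) hVm).comp (hφ.comp hextend)
    (measurable_pi_apply ⟨n, Finset.mem_singleton_self n⟩)
  have hpast : (fun ω => φ fun k => V k ω)
      = (φ ∘ extend) ∘ fun ω (i : Finset.range n) => V i ω := by
    funext ω
    refine hdep fun k hk => ?_
    simp only [extend, Finset.mem_range, Set.mem_Iio.1 hk, dif_pos]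
  rwa [hpast]

lemma ae_pos_of_map_eq_expMeasure {Ω : Type*} [MeasurableSpace Ω] {P : Measure Ω} {v : Ω → ℝ}
    (hv : Measurable v) (hlaw : P.map v = expMeasure 1) : ∀ᵐ ω ∂P, 0 < v ω := by
  have := isProbabilityMeasure_expMeasure one_pos
  have hnull : expMeasure 1 (Set.Iic 0) = 0 := by
    rw [← ofReal_cdf, cdf_expMeasure_eq one_pos]
    simp
  rw [← hlaw] at hnull
  filter_upwards [ae_of_ae_map hv.aemeasurable (measure_eq_zero_iff_ae_notMem.1 hnull)] with ω hω
  exact not_le.1 hω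

section Arrivals

variable {Ω : Type*} [MeasurableSpace Ω] {P : Measure Ω} [IsProbabilityMeasure P] {V : ℕ → Ω → ℝ}

lemma ae_tendsto_sum_atTop (hV : iIndepFun V P) (hident : ∀ k, IdentDistrib (V k) (V 0) P P)
    (hpos : ∀ᵐ ω ∂P, 0 < V 0 ω) :
    ∀ᵐ ω ∂P, Tendsto (fun n => ∑ k ∈ Finset.range n, V k ω) atTop atTop := by
  have hmin : Measurable fun v : ℝ => min v 1 := by fun_prop
  have hmeas (k : ℕ) : AEMeasurable (fun ω => min (V k ω) 1) P :=
    hmin.comp_aemeasurable (hident k).aemeasurable_fst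
  have hint : Integrable (fun ω => min (V 0 ω) 1) P := by
    refine Integrable.of_bound (hmeas 0).aestronglyMeasurable 1 ?_
    filter_upwards [hpos] with ω hω
    rw [Real.norm_of_nonneg (le_min hω.le zero_le_one)]
    exact min_le_right _ _
  have hmean : 0 < ∫ ω, min (V 0 ω) 1 ∂P := by
    have hmin_pos : ∀ᵐ ω ∂P, 0 < min (V 0 ω) 1 := by
      filter_upwards [hpos] with ω hω using lt_min hω one_pos
    have hsupport : Function.support (fun ω => min (V 0 ω) 1) =ᵐ[P] Set.univ :=
      eventuallyEq_univ.2 (hmin_pos.mono fun _ h => h.ne')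
    rw [integral_pos_iff_support_of_nonneg_ae (hmin_pos.mono fun _ h => h.le) hint,
      measure_congr hsupport, measure_univ]
    exact one_pos
  filter_upwards [strong_law_ae_real (fun k ω => min (V k ω) 1) hint
    (fun i j hij => (hV.indepFun hij).comp hmin hmin) fun k => (hident k).comp hmin] with ω hω
  have hsum : Tendsto (fun n => ∑ k ∈ Finset.range n, min (V k ω) 1) atTop atTop := by
    refine (hω.pos_mul_atTop hmean tendsto_natCast_atTop_atTop).congr' ?_
    filter_upwards [eventually_ne_atTop 0] with n hn
    exact div_mul_cancel₀ _ (Nat.cast_ne_zero.2 hn)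
  exact tendsto_atTop_mono (fun n => Finset.sum_le_sum fun k _ => min_le_left _ _) hsum

variable {ξ : ℕ → Ω → ℝ}

lemma tendsto_measure_forall_lt_le_arrival (hVm : ∀ k, Measurable (V k))
    (hξm : ∀ k, Measurable (ξ k)) :
    Tendsto (fun n => P {ω | ∀ i < n, ξ i ω ≤ ∑ k ∈ Finset.range (i + 1), V k ω}) atTop
      (𝓝 (P {ω | ∀ i, ξ i ω ≤ ∑ k ∈ Finset.range (i + 1), V k ω})) := by
  have hinter : {ω | ∀ i, ξ i ω ≤ ∑ k ∈ Finset.range (i + 1), V k ω}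
      = ⋂ n, {ω | ∀ i < n, ξ i ω ≤ ∑ k ∈ Finset.range (i + 1), V k ω} := by
    ext ω
    simp only [Set.mem_iInter, Set.mem_ofPred_eq]
    exact ⟨fun h _ i _ => h i, fun h i => h (i + 1) i i.lt_succ_self⟩
  rw [hinter]
  refine tendsto_measure_iInter_atTop (fun n => MeasurableSet.nullMeasurableSet ?_)
    (fun m n hmn ω hω i hi => hω i (hi.trans_le hmn)) ⟨0, measure_ne_top _ _⟩
  simp only [Set.ofPred_forall]
  exact .iInter fun i => .iInter fun _ => measurableSet_le (hξm i) (by fun_prop)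

variable {κ : Measure ℝ} [IsProbabilityMeasure κ]

lemma measure_forall_lt_le_arrival (hVm : ∀ k, Measurable (V k)) (hξm : ∀ k, Measurable (ξ k))
    (hξ : iIndepFun ξ P) (hκ : ∀ k, P.map (ξ k) = κ)
    (hVξ : IndepFun (fun ω k => V k ω) (fun ω k => ξ k ω) P) (n : ℕ) :
    P {ω | ∀ i < n, ξ i ω ≤ ∑ k ∈ Finset.range (i + 1), V k ω}
      = ∫⁻ ω, ∏ i ∈ Finset.range n,
          ENNReal.ofReal (cdf κ (∑ k ∈ Finset.range (i + 1), V k ω)) ∂P := by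
  have hVm' : Measurable fun ω k => V k ω := measurable_pi_lambda _ hVm
  have hξm' : Measurable fun ω k => ξ k ω := measurable_pi_lambda _ hξm
  let A : Set ((ℕ → ℝ) × (ℕ → ℝ)) :=
    {p | ∀ i < n, p.2 i ≤ ∑ k ∈ Finset.range (i + 1), p.1 k}
  have hA : MeasurableSet A := by
    simp only [A, Set.ofPred_forall]
    exact .iInter fun i => .iInter fun _ => measurableSet_le (by fun_prop) (by fun_prop)
  have hprod := lintegral_comp_prodMk_of_indepFun hVξ hVm' hξm'
    (f := A.indicator 1) (measurable_one.indicator hA)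
  calc P {ω | ∀ i < n, ξ i ω ≤ ∑ k ∈ Finset.range (i + 1), V k ω}
      = ∫⁻ ω, A.indicator 1 (fun k => V k ω, fun k => ξ k ω) ∂P :=
        (lintegral_indicator_one (hVm'.prodMk hξm' hA)).symm
    _ = ∫⁻ ω, P.map (fun ω k => ξ k ω) (Prod.mk (fun k => V k ω) ⁻¹' A) ∂P := by
        rw [hprod]
        exact lintegral_congr fun ω => lintegral_indicator_one (measurable_prodMk_left hA)
    _ = _ := lintegral_congr fun ω => ?_
  have hinter : (fun ω k => ξ k ω) ⁻¹' (Prod.mk (fun k => V k ω) ⁻¹' A)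
      = ⋂ i ∈ Finset.range n, ξ i ⁻¹' Set.Iic (∑ k ∈ Finset.range (i + 1), V k ω) := by
    ext ω'
    simp [A]
  rw [Measure.map_apply hξm' (measurable_prodMk_left hA), hinter,
    hξ.measure_inter_preimage_eq_mul (Finset.range n) fun i _ => measurableSet_Iic]
  refine Finset.prod_congr rfl fun i _ => ?_
  rw [ofReal_cdf, ← hκ i, Measure.map_apply (hξm i) measurableSet_Iic]

/-- The integrand is the conditional probability, given the first `n` arrivals, that no mark exceeds
its arrival time. It is a martingale, so its mean does not depend on `n`. -/
lemma lintegral_prod_cdf_mul_voidProb (hVm : ∀ k, Measurable (V k)) (hV : iIndepFun V P)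
    (hlaw : ∀ k, P.map (V k) = expMeasure 1) (hκ : Integrable id κ) (n : ℕ) :
    ∫⁻ ω, (∏ i ∈ Finset.range n, ENNReal.ofReal (cdf κ (∑ k ∈ Finset.range (i + 1), V k ω))) *
      ENNReal.ofReal (voidProb κ (∑ k ∈ Finset.range n, V k ω)) ∂P
      = ENNReal.ofReal (voidProb κ 0) := by
  have hcdf : Measurable (cdf κ) := (monotone_cdf κ).measurable
  have hvoid := (continuous_voidProb hκ).measurable
  induction n with
  | zero => simp
  | succ n ih =>
    let past (y : ℕ → ℝ) : ℝ≥0∞ × ℝ :=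
      (∏ i ∈ Finset.range n, ENNReal.ofReal (cdf κ (∑ k ∈ Finset.range (i + 1), y k)),
        ∑ k ∈ Finset.range n, y k)
    have hpast : Measurable past := by fun_prop
    have hdep : DependsOn past (Set.Iio n) := fun y y' hy => by
      have hsum (i : ℕ) (hi : i ≤ n) : ∑ k ∈ Finset.range i, y k = ∑ k ∈ Finset.range i, y' k :=
        Finset.sum_congr rfl fun k hk => hy k ((Finset.mem_range.1 hk).trans_le hi)
      simp only [past, hsum n le_rfl]
      congr 1
      exact Finset.prod_congr rfl fun i hi => by rw [hsum _ (Finset.mem_range.1 hi)]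
    have hstep := lintegral_comp_prodMk_of_indepFun
      (indepFun_of_dependsOn_Iio hV hVm hpast hdep)
      (hpast.comp (measurable_pi_lambda _ hVm)) (hVm n)
      (f := fun p => p.1.1 *
        (ENNReal.ofReal (cdf κ (p.1.2 + p.2)) * ENNReal.ofReal (voidProb κ (p.1.2 + p.2))))
      (by fun_prop)
    rw [← ih]
    simp only [Finset.prod_range_succ, mul_assoc, Finset.sum_range_succ _ n]
    refine hstep.trans (lintegral_congr fun ω => ?_)
    rw [hlaw n, lintegral_const_mul _ (by fun_prop), lintegral_cdf_mul_voidProb hκ]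

lemma tendsto_lintegral_one_sub_voidProb (hVm : ∀ k, Measurable (V k)) (hV : iIndepFun V P)
    (hlaw : ∀ k, P.map (V k) = expMeasure 1) (hκ : Integrable id κ) :
    Tendsto (fun n => ∫⁻ ω, (1 - ENNReal.ofReal (voidProb κ (∑ k ∈ Finset.range n, V k ω))) ∂P)
      atTop (𝓝 0) := by
  have hvoid := (continuous_voidProb hκ).measurable
  have hident (k : ℕ) : IdentDistrib (V k) (V 0) P P :=
    ⟨(hVm k).aemeasurable, (hVm 0).aemeasurable, (hlaw k).trans (hlaw 0).symm⟩
  have hptwise : ∀ᵐ ω ∂P, Tendsto (fun n => 1 - ENNReal.ofReal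
      (voidProb κ (∑ k ∈ Finset.range n, V k ω))) atTop (𝓝 0) := by
    filter_upwards [ae_tendsto_sum_atTop hV hident (ae_pos_of_map_eq_expMeasure (hVm 0) (hlaw 0))]
      with ω hω
    have hone := ENNReal.tendsto_ofReal ((tendsto_voidProb_atTop κ).comp hω)
    simpa using ENNReal.Tendsto.sub (tendsto_const_nhds (x := (1 : ℝ≥0∞))) hone (.inl (by simp))
  simpa only [lintegral_zero] using tendsto_lintegral_of_dominated_convergence (fun _ => 1)
    (fun n => by fun_prop) (fun n => ae_of_all _ fun ω => tsub_le_self) (by simp) hptwise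

theorem measure_forall_le_arrival (hVm : ∀ k, Measurable (V k)) (hV : iIndepFun V P)
    (hlaw : ∀ k, P.map (V k) = expMeasure 1) (hξm : ∀ k, Measurable (ξ k)) (hξ : iIndepFun ξ P)
    (hκ : ∀ k, P.map (ξ k) = κ) (hVξ : IndepFun (fun ω k => V k ω) (fun ω k => ξ k ω) P)
    (hint : Integrable id κ) :
    P {ω | ∀ i, ξ i ω ≤ ∑ k ∈ Finset.range (i + 1), V k ω}
      = ENNReal.ofReal (Real.exp (-(∫⁻ x, ENNReal.ofReal x ∂κ).toReal)) := by
  have hcdf : Measurable (cdf κ) := (monotone_cdf κ).measurable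
  have hvoid := (continuous_voidProb hint).measurable
  let F (n : ℕ) (ω : Ω) : ℝ≥0∞ := ∏ i ∈ Finset.range n,
    ENNReal.ofReal (cdf κ (∑ k ∈ Finset.range (i + 1), V k ω))
  let H (n : ℕ) (ω : Ω) : ℝ≥0∞ := ENNReal.ofReal (voidProb κ (∑ k ∈ Finset.range n, V k ω))
  have hF_le (n : ℕ) (ω : Ω) : F n ω ≤ 1 := Finset.prod_le_one' fun i _ =>
    ENNReal.ofReal_le_one.2 (cdf_le_one κ _)
  have hH_le (n : ℕ) (ω : Ω) : H n ω ≤ 1 := ENNReal.ofReal_le_one.2 (voidProb_le_one κ _)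
  have hmartingale (n : ℕ) : ∫⁻ ω, F n ω * H n ω ∂P = ENNReal.ofReal (voidProb κ 0) :=
    lintegral_prod_cdf_mul_voidProb hVm hV hlaw hint n
  have hgap : Tendsto (fun n => ∫⁻ ω, (1 - H n ω) ∂P) atTop (𝓝 0) :=
    tendsto_lintegral_one_sub_voidProb hVm hV hlaw hint
  have hlim : Tendsto (fun n => ∫⁻ ω, F n ω ∂P) atTop (𝓝 (ENNReal.ofReal (voidProb κ 0))) := by
    refine tendsto_of_tendsto_of_tendsto_of_le_of_le tendsto_const_nhds
      (by simpa only [add_zero] using hgap.const_add (ENNReal.ofReal (voidProb κ 0)))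
      (fun n => ?_) (fun n => ?_)
    · exact (hmartingale n).symm.trans_le
        (lintegral_mono fun ω => mul_le_of_le_one_right' (hH_le n ω))
    · rw [← hmartingale n, ← lintegral_add_left (by fun_prop)]
      refine lintegral_mono fun ω => ?_
      calc F n ω = F n ω * H n ω + F n ω * (1 - H n ω) := by
            rw [← mul_add, add_tsub_cancel_of_le (hH_le n ω), mul_one]
        _ ≤ _ := by gcongr; exact mul_le_of_le_one_left' (hF_le n ω)
  rw [← voidProb_zero hint]
  refine tendsto_nhds_unique ?_ hlim
  simp only [F, ← measure_forall_lt_le_arrival hVm hξm hξ hκ hVξ]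
  exact tendsto_measure_forall_lt_le_arrival hVm hξm

end Arrivals

section ExceedanceEvents

variable {ι : Type*} {n : ℕ} (t : Fin n → ι) (c : Fin n → ℝ≥0)

lemma measurableSet_forall_le : MeasurableSet {f : ι → ℝ≥0 | ∀ j, f (t j) ≤ c j} := by
  simp only [Set.ofPred_forall]
  exact .iInter fun j => measurable_pi_apply (t j) measurableSet_Iic

lemma measurableSet_exists_lt : MeasurableSet {f : ι → ℝ≥0 | ∃ j, c j < f (t j)} := by
  simp only [Set.ofPred_exists]
  exact .iUnion fun j => measurable_pi_apply (t j) measurableSet_Ioi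

variable (ι) in
/-- The sets of paths that stay below finitely many positive levels. The level zero is excluded
because the exponent measure of a max-stable field charges the complement of `{f | f t ≤ 0}` with
infinite mass. -/
def levelBoxes : Set (Set (ι → ℝ≥0)) :=
  {S | ∃ (n : ℕ) (t : Fin n → ι) (c : Fin n → ℝ≥0), (∀ j, 0 < c j) ∧
    S = {f | ∀ j, f (t j) ≤ c j}}

lemma isPiSystem_levelBoxes : IsPiSystem (levelBoxes ι) := by
  rintro _ ⟨n, t, c, hc, rfl⟩ _ ⟨m, t', c', hc', rfl⟩ -
  refine ⟨n + m, Fin.append t t', Fin.append c c', ?_, ?_⟩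
  · simpa only [Fin.forall_fin_add, Fin.append_left, Fin.append_right] using ⟨hc, hc'⟩
  · ext f
    simp only [Fin.forall_fin_add, Fin.append_left, Fin.append_right, Set.mem_inter_iff,
      Set.mem_ofPred_eq]

lemma measurable_of_forall_pos_Iic {α : Type*} [MeasurableSpace α] {g : α → ℝ≥0}
    (hg : ∀ c, 0 < c → MeasurableSet (g ⁻¹' Set.Iic c)) : Measurable g := by
  refine measurable_of_Iic fun c => ?_
  obtain ⟨u, -, hu_gt, hu_lim⟩ := exists_seq_strictAnti_tendsto c
  have hinter : g ⁻¹' Set.Iic c = ⋂ k, g ⁻¹' Set.Iic (u k) := by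
    ext x
    rw [Set.mem_iInter]
    exact ⟨fun h k => le_trans (Set.mem_Iic.1 h) (hu_gt k).le, fun h => ge_of_tendsto' hu_lim h⟩
  rw [hinter]
  exact .iInter fun k => hg _ (zero_le.trans_lt (hu_gt k))

lemma generateFrom_levelBoxes :
    (MeasurableSpace.pi : MeasurableSpace (ι → ℝ≥0)) =
      MeasurableSpace.generateFrom (levelBoxes ι) := by
  apply le_antisymm
  · refine iSup_le fun i => measurable_iff_comap_le.1 ?_
    refine @measurable_of_forall_pos_Iic _ (MeasurableSpace.generateFrom (levelBoxes ι)) _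
      fun c hc => MeasurableSpace.measurableSet_generateFrom
        ⟨1, fun _ => i, fun _ => c, fun _ => hc, ?_⟩
    ext f
    simp
  · refine MeasurableSpace.generateFrom_le ?_
    rintro _ ⟨n, t, c, -, rfl⟩
    exact measurableSet_forall_le t c

lemma measure_restrict_forall_le_add_exists_lt (m : Measure (ι → ℝ≥0)) (i : ι) :
    m.restrict {f | 1 < f i} {f | ∀ j, f (t j) ≤ c j} + m {f | ∃ j, c j < f (t j)}
      = m {f | ∃ j : Fin (n + 1), (Fin.cons 1 c : _ → ℝ≥0) j < f ((Fin.cons i t : _ → ι) j)} := by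
  rw [Measure.restrict_apply (measurableSet_forall_le t c),
    ← measure_union _ (measurableSet_exists_lt t c)]
  · congr 1
    ext f
    simp only [Set.mem_union, Set.mem_inter_iff, Set.mem_ofPred_eq, Fin.exists_fin_succ,
      Fin.cons_zero, Fin.cons_succ, ← not_lt, ← not_exists]
    tauto
  · exact Set.disjoint_left.2 fun f hf ⟨j, hj⟩ => (hf.1 j).not_gt hj

lemma restrict_one_lt_eq {m m' : Measure (ι → ℝ≥0)}
    (hfin : ∀ (n : ℕ) (t : Fin n → ι) (c : Fin n → ℝ≥0), (∀ j, 0 < c j) →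
      m {f | ∃ j, c j < f (t j)} ≠ ∞)
    (heq : ∀ (n : ℕ) (t : Fin n → ι) (c : Fin n → ℝ≥0), (∀ j, 0 < c j) →
      m {f | ∃ j, c j < f (t j)} = m' {f | ∃ j, c j < f (t j)}) (i : ι) :
    m.restrict {f | 1 < f i} = m'.restrict {f | 1 < f i} := by
  have hone : m {f | 1 < f i} = m' {f | 1 < f i} ∧ m {f | 1 < f i} ≠ ∞ := by
    simpa only [exists_const] using
      And.intro (heq 1 (fun _ => i) (fun _ => 1) fun _ => one_pos)
        (hfin 1 (fun _ => i) (fun _ => 1) fun _ => one_pos)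
  have : IsFiniteMeasure (m.restrict {f | 1 < f i}) :=
    ⟨by simpa only [Measure.restrict_apply_univ] using hone.2.lt_top⟩
  refine ext_of_generate_finite _ generateFrom_levelBoxes isPiSystem_levelBoxes ?_
    (by simp [hone.1])
  rintro _ ⟨n, t, c, hc, rfl⟩
  refine (ENNReal.add_left_inj (hfin n t c hc)).1 ?_
  rw [measure_restrict_forall_le_add_exists_lt, heq n t c hc,
    measure_restrict_forall_le_add_exists_lt]
  exact heq _ _ _ (Fin.cases one_pos hc)

lemma identDistrib_restrict_one_lt {α β : Type*} [MeasurableSpace α] [MeasurableSpace β]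
    {m : Measure α} {m' : Measure β} {X : α → ι → ℝ≥0} {X' : β → ι → ℝ≥0}
    (hX : Measurable X) (hX' : Measurable X')
    (hfin : ∀ (n : ℕ) (t : Fin n → ι) (c : Fin n → ℝ≥0), (∀ j, 0 < c j) →
      m {a | ∃ j, c j < X a (t j)} ≠ ∞)
    (heq : ∀ (n : ℕ) (t : Fin n → ι) (c : Fin n → ℝ≥0), (∀ j, 0 < c j) →
      m {a | ∃ j, c j < X a (t j)} = m' {b | ∃ j, c j < X' b (t j)}) (i : ι) :
    IdentDistrib X X' (m.restrict {a | 1 < X a i}) (m'.restrict {b | 1 < X' b i}) := by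
  refine ⟨hX.aemeasurable, hX'.aemeasurable, ?_⟩
  have hmap (n : ℕ) (t : Fin n → ι) (c : Fin n → ℝ≥0) :
      m.map X {f | ∃ j, c j < f (t j)} = m {a | ∃ j, c j < X a (t j)} :=
    Measure.map_apply hX (measurableSet_exists_lt t c)
  have hmap' (n : ℕ) (t : Fin n → ι) (c : Fin n → ℝ≥0) :
      m'.map X' {f | ∃ j, c j < f (t j)} = m' {b | ∃ j, c j < X' b (t j)} :=
    Measure.map_apply hX' (measurableSet_exists_lt t c)
  have hone : MeasurableSet {f : ι → ℝ≥0 | 1 < f i} := measurable_pi_apply i measurableSet_Ioi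
  have h := restrict_one_lt_eq (m := m.map X) (m' := m'.map X')
    (by simpa only [hmap] using hfin) (by simpa only [hmap, hmap'] using heq) i
  rwa [Measure.restrict_map hX hone, Measure.restrict_map hX' hone] at h

end ExceedanceEvents

section DeHaan

/-- The paths `Z / s`. Under `P.prod (volume.restrict (Set.Ioi 0))` their law is the exponent
measure `∫_0^∞ P(Z / s ∈ ·) ds` of the max-stable field with spectral field `Z`. -/
noncomputable def scaledField {Ω ι : Type*} (Z : Ω → ι → ℝ≥0) (p : Ω × ℝ) : ι → ℝ≥0 :=
  fun t => Z p.1 t / p.2.toNNReal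

variable {Ω ι : Type*} [MeasurableSpace Ω] {P : Measure Ω} {Z : Ω → ι → ℝ≥0}

lemma measurable_scaledField (hZ : Measurable Z) : Measurable (scaledField Z) :=
  measurable_pi_lambda _ fun t => by
    have := (measurable_pi_apply t).comp hZ
    unfold scaledField
    fun_prop

lemma setLIntegral_one_lt_scaledField (hZ : Measurable Z) (i : ι)
    {g : (ι → ℝ≥0) → ℝ≥0∞} (hg : Measurable g) :
    ∫⁻ p in {p | 1 < scaledField Z p i}, g (scaledField Z p)
        ∂P.prod (volume.restrict (Set.Ioi 0))
      = ∫⁻ ω, (∫⁻ s in Set.Ioo 0 (Z ω i : ℝ), g (scaledField Z (ω, s))) ∂P := by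
  have hX := measurable_scaledField hZ
  have hE : MeasurableSet {p | 1 < scaledField Z p i} :=
    hX (measurable_pi_apply i measurableSet_Ioi)
  have hgX : Measurable fun p => g (scaledField Z p) := hg.comp hX
  rw [← lintegral_indicator hE, lintegral_prod _ (hgX.indicator hE).aemeasurable]
  refine lintegral_congr fun ω => ?_
  have hsection : Prod.mk ω ⁻¹' {p | 1 < scaledField Z p i} ∩ Set.Ioi 0
      = Set.Ioo 0 (Z ω i : ℝ) := by
    ext s
    simp only [Set.mem_inter_iff, Set.mem_preimage, Set.mem_ofPred_eq, Set.mem_Ioi, Set.mem_Ioo,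
      scaledField, and_comm (b := 0 < s)]
    refine and_congr_right fun hs => ?_
    rw [one_lt_div (Real.toNNReal_pos.2 hs), Real.toNNReal_lt_iff_lt_coe hs.le]
  rw [← hsection, ← Measure.restrict_restrict (measurable_prodMk_left hE),
    ← lintegral_indicator (measurable_prodMk_left hE)]
  rfl

/-- The largest of the ratios `f (t j) / c j`, and `0` if there are none. -/
noncomputable def maxRatio {n : ℕ} (t : Fin n → ι) (c : Fin n → ℝ≥0) (f : ι → ℝ≥0) : ℝ≥0 :=
  Finset.univ.sup fun j => f (t j) / c j

variable {n : ℕ} (t : Fin n → ι) (c : Fin n → ℝ≥0)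

lemma measurable_maxRatio : Measurable (maxRatio t c) := by
  unfold maxRatio
  fun_prop

lemma lintegral_maxRatio_ne_top (hZ : Measurable Z) (hmean : ∀ s, ∫⁻ ω, (Z ω s : ℝ≥0∞) ∂P ≠ ∞) :
    ∫⁻ ω, (maxRatio t c (Z ω) : ℝ≥0∞) ∂P ≠ ∞ := by
  have hcoord (s : ι) : Measurable fun ω => Z ω s := (measurable_pi_apply s).comp hZ
  have hle (ω : Ω) : (maxRatio t c (Z ω) : ℝ≥0∞) ≤ ∑ j, ((c j)⁻¹ : ℝ≥0) * (Z ω (t j) : ℝ≥0∞) := by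
    have : maxRatio t c (Z ω) ≤ ∑ j, (c j)⁻¹ * Z ω (t j) := Finset.sup_le fun j _ => by
      rw [div_eq_inv_mul]
      exact Finset.single_le_sum (f := fun j => (c j)⁻¹ * Z ω (t j)) (fun _ _ => zero_le)
        (Finset.mem_univ j)
    exact_mod_cast this
  refine ((lintegral_mono hle).trans_lt ?_).ne
  rw [lintegral_finsetSum _ fun j _ => ((hcoord (t j)).coe_nnreal_ennreal.const_mul _)]
  refine ENNReal.sum_lt_top.2 fun j _ => ?_
  rw [lintegral_const_mul _ (hcoord (t j)).coe_nnreal_ennreal]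
  exact ENNReal.mul_lt_top ENNReal.coe_lt_top (hmean (t j)).lt_top

variable {t c}

lemma measure_exists_lt_scaledField (hZ : Measurable Z) (hc : ∀ j, 0 < c j) :
    P.prod (volume.restrict (Set.Ioi 0)) {p | ∃ j, c j < scaledField Z p (t j)}
      = ∫⁻ ω, (maxRatio t c (Z ω) : ℝ≥0∞) ∂P := by
  have hA : MeasurableSet {p : Ω × ℝ | ∃ j, c j < scaledField Z p (t j)} :=
    measurable_scaledField hZ (measurableSet_exists_lt t c)
  rw [Measure.prod_apply hA]
  refine lintegral_congr fun ω => ?_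
  have hsection : Prod.mk ω ⁻¹' {p | ∃ j, c j < scaledField Z p (t j)} ∩ Set.Ioi 0
      = Set.Ioo 0 (maxRatio t c (Z ω) : ℝ) := by
    ext s
    simp only [Set.mem_inter_iff, Set.mem_preimage, Set.mem_ofPred_eq, Set.mem_Ioi, Set.mem_Ioo,
      scaledField, and_comm (b := 0 < s)]
    refine and_congr_right fun hs => ?_
    have hs' : 0 < s.toNNReal := Real.toNNReal_pos.2 hs
    rw [← Real.toNNReal_lt_iff_lt_coe hs.le, maxRatio, Finset.lt_sup_iff]
    simp only [Finset.mem_univ, true_and, lt_div_iff₀ hs', lt_div_iff₀ (hc _),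
      mul_comm (s.toNNReal)]
  rw [Measure.restrict_apply (measurable_prodMk_left hA), hsection, Real.volume_Ioo, sub_zero,
    ENNReal.ofReal_coe_nnreal]

end DeHaan

section MaxStable

lemma deHaanField_le_iff {Ω₁ : Type*} {d : ℕ} {V : ℕ → Ω₁ → ℝ}
    {W : ℕ → Ω₁ → (Fin d → ℝ) → ℝ≥0} {ω : Ω₁} (hV : ∀ k, 0 < V k ω) {n : ℕ}
    {t : Fin n → Fin d → ℝ} {c : Fin n → ℝ≥0} (hc : ∀ j, 0 < c j) :
    (∀ j, deHaanField V W (t j) ω ≤ c j) ↔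
      ∀ i, (maxRatio t c (W i ω) : ℝ) ≤ ∑ k ∈ Finset.range (i + 1), V k ω := by
  simp only [deHaanField, iSup_le_iff]
  rw [forall_comm]
  refine forall_congr' fun i => ?_
  have hΓ : 0 < ∑ k ∈ Finset.range (i + 1), V k ω := Finset.sum_pos (fun k _ => hV k) (by simp)
  have hΓ' : 0 < (∑ k ∈ Finset.range (i + 1), V k ω).toNNReal := Real.toNNReal_pos.2 hΓ
  rw [← Real.le_toNNReal_iff_coe_le hΓ.le, maxRatio, Finset.sup_le_iff]
  simp only [Finset.mem_univ, true_imp_iff, ENNReal.ofReal, ← ENNReal.coe_div hΓ'.ne',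
    ENNReal.coe_le_coe, div_le_iff₀ hΓ', div_le_iff₀ (hc _), mul_comm]

variable {Ω Ω₁ : Type*} [MeasurableSpace Ω] [MeasurableSpace Ω₁] {P : Measure Ω}
  [IsProbabilityMeasure P] {P₁ : Measure Ω₁} [IsProbabilityMeasure P₁] {d : ℕ}
  {Z : Ω → (Fin d → ℝ) → ℝ≥0} {V : ℕ → Ω₁ → ℝ} {W : ℕ → Ω₁ → (Fin d → ℝ) → ℝ≥0}

lemma measure_deHaanField_le (hZ : Measurable Z) (hmean : ∀ s, ∫⁻ ω, (Z ω s : ℝ≥0∞) ∂P ≠ ∞)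
    (hVW : IsDeHaanSample P Z P₁ V W) {n : ℕ} (t : Fin n → Fin d → ℝ) {c : Fin n → ℝ≥0}
    (hc : ∀ j, 0 < c j) :
    P₁ {ω | ∀ j, deHaanField V W (t j) ω ≤ c j}
      = ENNReal.ofReal (Real.exp (-(∫⁻ ω, (maxRatio t c (Z ω) : ℝ≥0∞) ∂P).toReal)) := by
  have hφ : Measurable fun f => (maxRatio t c f : ℝ) := (measurable_maxRatio t c).coe_nnreal_real
  have hφZ : Measurable fun ω => (maxRatio t c (Z ω) : ℝ) := hφ.comp hZ
  let κ : Measure ℝ := P.map fun ω => (maxRatio t c (Z ω) : ℝ)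
  have : IsProbabilityMeasure κ := Measure.isProbabilityMeasure_map hφZ.aemeasurable
  have hκ (k : ℕ) : P₁.map (fun ω => (maxRatio t c (W k ω) : ℝ)) = κ := by
    have h := congrArg (Measure.map fun f => (maxRatio t c f : ℝ)) (hVW.law_W k)
    rwa [Measure.map_map hφ (hVW.measurable_W k), Measure.map_map hφ hZ] at h
  have hκ_mean : ∫⁻ x, ENNReal.ofReal x ∂κ = ∫⁻ ω, (maxRatio t c (Z ω) : ℝ≥0∞) ∂P := by
    rw [lintegral_map ENNReal.measurable_ofReal hφZ]
    simp only [ENNReal.ofReal_coe_nnreal]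
  have hκ_int : Integrable id κ := by
    rw [integrable_map_measure aestronglyMeasurable_id hφZ.aemeasurable, Function.id_comp]
    refine ⟨hφZ.aestronglyMeasurable, ?_⟩
    rw [hasFiniteIntegral_iff_ofReal (ae_of_all _ fun ω => NNReal.coe_nonneg _)]
    simpa only [ENNReal.ofReal_coe_nnreal] using
      (lintegral_maxRatio_ne_top t c hZ hmean).lt_top
  have hindep : IndepFun (fun ω k => V k ω) (fun ω k => (maxRatio t c (W k ω) : ℝ)) P₁ :=
    hVW.indep_VW.comp measurable_id
      (measurable_pi_lambda _ fun k => hφ.comp (measurable_pi_apply k))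
  rw [← hκ_mean, ← measure_forall_le_arrival hVW.measurable_V hVW.indep_V hVW.law_V
    (fun k => hφ.comp (hVW.measurable_W k)) (hVW.indep_W.comp (fun _ => _) fun _ => hφ) hκ hindep
    hκ_int]
  refine measure_congr ?_
  filter_upwards [ae_all_iff.2 fun k =>
    ae_pos_of_map_eq_expMeasure (hVW.measurable_V k) (hVW.law_V k)] with ω hω
  exact propext (deHaanField_le_iff hω hc)

lemma lintegral_maxRatio_shift (hZ : Measurable Z)
    (hmean : ∀ s, ∫⁻ ω, (Z ω s : ℝ≥0∞) ∂P ≠ ∞) (hVW : IsDeHaanSample P Z P₁ V W)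
    (hst : IsStationaryField P₁ (deHaanField V W)) (h : Fin d → ℝ) {n : ℕ}
    (t : Fin n → Fin d → ℝ) {c : Fin n → ℝ≥0} (hc : ∀ j, 0 < c j) :
    ∫⁻ ω, (maxRatio (fun j => t j + h) c (Z ω) : ℝ≥0∞) ∂P
      = ∫⁻ ω, (maxRatio t c (Z ω) : ℝ≥0∞) ∂P := by
  have hbox : MeasurableSet {y : Fin n → ℝ≥0∞ | ∀ j, y j ≤ c j} := by
    simp only [Set.ofPred_forall]
    exact .iInter fun j => measurable_pi_apply j measurableSet_Iic
  have hle : P₁ {ω | ∀ j, deHaanField V W (t j + h) ω ≤ c j}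
      = P₁ {ω | ∀ j, deHaanField V W (t j) ω ≤ c j} := (hst n t h).measure_mem_eq hbox
  rw [measure_deHaanField_le hZ hmean hVW _ hc, measure_deHaanField_le hZ hmean hVW _ hc,
    ENNReal.ofReal_eq_ofReal_iff (Real.exp_pos _).le (Real.exp_pos _).le, Real.exp_eq_exp,
    neg_inj] at hle
  exact (ENNReal.toReal_eq_toReal_iff' (lintegral_maxRatio_ne_top _ c hZ hmean)
    (lintegral_maxRatio_ne_top t c hZ hmean)).1 hle

theorem hasStationaryExceedances_scaledField (hZ : Measurable Z)
    (hmean : ∀ s, ∫⁻ ω, (Z ω s : ℝ≥0∞) ∂P ≠ ∞) (hVW : IsDeHaanSample P Z P₁ V W)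
    (hst : IsStationaryField P₁ (deHaanField V W)) :
    HasStationaryExceedances (P.prod (volume.restrict (Set.Ioi 0))) (scaledField Z) := by
  intro h
  have hX := measurable_scaledField hZ
  have hshift : Measurable fun p s => scaledField Z p (s + h) :=
    measurable_pi_lambda _ fun s => (measurable_pi_apply (s + h)).comp hX
  have hexceed (n : ℕ) (t : Fin n → Fin d → ℝ) (c : Fin n → ℝ≥0) (hc : ∀ j, 0 < c j) :=
    measure_exists_lt_scaledField (P := P) (t := t) hZ hc
  simpa only [zero_add] using identDistrib_restrict_one_lt hshift hX
    (fun n t c hc => by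
      rw [hexceed n _ c hc]
      exact lintegral_maxRatio_ne_top _ c hZ hmean)
    (fun n t c hc => by
      rw [hexceed n _ c hc, hexceed n t c hc, lintegral_maxRatio_shift hZ hmean hVW hst h t hc])
    0

end MaxStable

section Pareto

lemma ext_of_measure_Ioi_of_one_le {ρ ρ' : Measure ℝ} [IsProbabilityMeasure ρ]
    [IsProbabilityMeasure ρ'] (h : ∀ r, 1 ≤ r → ρ (Set.Ioi r) = ρ' (Set.Ioi r))
    (hone : ρ (Set.Ioi 1) = 1) : ρ = ρ' := by
  have hIoi (r : ℝ) : ρ (Set.Ioi r) = ρ' (Set.Ioi r) := by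
    rcases le_total 1 r with hr | hr
    · exact h r hr
    · have hfull {m : Measure ℝ} [IsProbabilityMeasure m] (hm : m (Set.Ioi 1) = 1) :
          m (Set.Ioi r) = 1 :=
        le_antisymm prob_le_one (hm ▸ measure_mono (Set.Ioi_subset_Ioi hr))
      rw [hfull hone, hfull (h 1 le_rfl ▸ hone)]
  refine Measure.ext_of_Iic _ _ fun r => ?_
  rw [← Set.compl_Ioi, prob_compl_eq_one_sub measurableSet_Ioi,
    prob_compl_eq_one_sub measurableSet_Ioi, hIoi]

lemma map_inv_uniform_Ioi {r : ℝ} (hr : 1 ≤ r) :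
    (volume.restrict (Set.Ioo (0 : ℝ) 1)).map (·⁻¹) (Set.Ioi r) = ENNReal.ofReal (1 / r) := by
  have hr0 : 0 < r := one_pos.trans_le hr
  have hpre : (·⁻¹) ⁻¹' Set.Ioi r ∩ Set.Ioo (0 : ℝ) 1 = Set.Ioo 0 (1 / r) := by
    ext u
    simp only [Set.mem_inter_iff, Set.mem_preimage, Set.mem_Ioi, Set.mem_Ioo, one_div]
    constructor
    · rintro ⟨hru, hu0, -⟩
      exact ⟨hu0, (lt_inv_comm₀ hr0 hu0).1 hru⟩
    · rintro ⟨hu0, hur⟩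
      exact ⟨(lt_inv_comm₀ hr0 hu0).2 hur, hu0, hur.trans_le (inv_le_one_of_one_le₀ hr)⟩
  rw [Measure.map_apply measurable_inv measurableSet_Ioi,
    Measure.restrict_apply (measurable_inv measurableSet_Ioi), hpre, Real.volume_Ioo, sub_zero]

lemma eq_map_inv_uniform {ρ : Measure ℝ} [IsProbabilityMeasure ρ]
    (h : ∀ r, 1 ≤ r → ρ (Set.Ioi r) = ENNReal.ofReal (1 / r)) :
    ρ = (volume.restrict (Set.Ioo (0 : ℝ) 1)).map (·⁻¹) := by
  have : IsProbabilityMeasure (volume.restrict (Set.Ioo (0 : ℝ) 1)) := ⟨by simp⟩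
  have := Measure.isProbabilityMeasure_map (μ := volume.restrict (Set.Ioo (0 : ℝ) 1))
    measurable_inv.aemeasurable
  exact ext_of_measure_Ioi_of_one_le (fun r hr => (h r hr).trans (map_inv_uniform_Ioi hr).symm)
    (by simpa using h 1 le_rfl)

lemma mul_setLIntegral_Ioo_comp_mul {a : ℝ} (ha : 0 < a) {F : ℝ → ℝ≥0∞} (hF : Measurable F) :
    ENNReal.ofReal a * ∫⁻ u in Set.Ioo 0 1, F (a * u) = ∫⁻ s in Set.Ioo 0 a, F s := by
  have hpre : (a * ·) ⁻¹' Set.Ioo 0 a = Set.Ioo 0 1 := by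
    ext u
    simp only [Set.mem_preimage, Set.mem_Ioo, mul_pos_iff_of_pos_left ha,
      mul_lt_iff_lt_one_right ha]
  rw [← hpre, ← setLIntegral_map measurableSet_Ioo hF (measurable_const_mul a), ← smul_eq_mul,
    ← lintegral_smul_measure, ← Measure.restrict_smul]
  conv_rhs => rw [← Real.smul_map_volume_mul_left ha.ne', abs_of_pos ha]

lemma mul_setLIntegral_inv_mul_div {ι : Type*} (f : ι → ℝ≥0) (i : ι) {g : (ι → ℝ≥0) → ℝ≥0∞}
    (hg : Measurable g) :
    f i * ∫⁻ u in Set.Ioo (0 : ℝ) 1, g (fun t => u⁻¹.toNNReal * (f t / f i))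
      = ∫⁻ s in Set.Ioo 0 (f i : ℝ), g (fun t => f t / s.toNNReal) := by
  rcases eq_or_ne (f i) 0 with hi | hi
  · simp [hi]
  · have hdiv : Measurable fun s : ℝ => g fun t => f t / s.toNNReal :=
      hg.comp (measurable_pi_lambda _ fun t => measurable_real_toNNReal.const_div _)
    rw [← mul_setLIntegral_Ioo_comp_mul (NNReal.coe_pos.2 (pos_iff_ne_zero.2 hi)) hdiv,
      ENNReal.ofReal_coe_nnreal]
    congr 2
    funext u
    congr 1
    funext t
    rw [Real.toNNReal_inv, Real.toNNReal_mul (f i).coe_nonneg, Real.toNNReal_coe,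
      div_mul_eq_div_div, div_eq_inv_mul _ u.toNNReal]

end Pareto

section TailField

/-- The tail field `Y = R Θ`, with values in `ℝ≥0` by truncating `R` at zero. -/
noncomputable def tailField {Ω₂ : Type*} {d : ℕ} (R : Ω₂ → ℝ)
    (Θ : Ω₂ → (Fin d → ℝ) → ℝ≥0) (ω : Ω₂) : (Fin d → ℝ) → ℝ≥0 :=
  fun t => (R ω).toNNReal * Θ ω t

lemma sojournY_eq_exceedanceVolume {Ω₂ : Type*} {d : ℕ} (δ : ℝ) (R : Ω₂ → ℝ)
    (Θ : Ω₂ → (Fin d → ℝ) → ℝ≥0) (ω : Ω₂) :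
    sojournY δ R Θ ω = exceedanceVolume (gridMeasure d δ) Set.univ (tailField R Θ ω) := by
  rw [sojournY, sojourn, exceedanceVolume]
  congr 2
  ext t
  simp only [Set.mem_ofPred_eq, tailField]
  rcases le_total 0 (R ω) with h | h
  · rw [← NNReal.coe_lt_coe, NNReal.coe_mul, Real.coe_toNNReal _ h, NNReal.coe_one]
  · rw [Real.toNNReal_of_nonpos h, zero_mul]
    exact iff_of_false
      ((mul_nonpos_of_nonpos_of_nonneg h (NNReal.coe_nonneg _)).trans zero_le_one).not_gt
      not_lt_zero

variable {Ω Ω₂ : Type*} [MeasurableSpace Ω] [MeasurableSpace Ω₂] {P : Measure Ω}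
  {P₂ : Measure Ω₂} {d : ℕ} {Z : Ω → (Fin d → ℝ) → ℝ≥0} {R : Ω₂ → ℝ}
  {Θ : Ω₂ → (Fin d → ℝ) → ℝ≥0}

lemma measurable_tailField (hR : Measurable R) (hΘ : Measurable Θ) : Measurable (tailField R Θ) :=
  measurable_pi_lambda _ fun t => hR.real_toNNReal.mul ((measurable_pi_apply t).comp hΘ)

lemma lintegral_comp_tailField [IsProbabilityMeasure P₂] (hZ : ∀ t, Measurable fun ω => Z ω t)
    (hR : Measurable R)
    (hR_survival : ∀ r, 1 ≤ r → P₂ {ω | r < R ω} = ENNReal.ofReal (1 / r))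
    (hΘ : Measurable Θ) (hΘ_law : P₂.map Θ = tiltedLaw P Z) (hRΘ : IndepFun R Θ P₂)
    {g : ((Fin d → ℝ) → ℝ≥0) → ℝ≥0∞} (hg : Measurable g) :
    ∫⁻ ω, g (tailField R Θ ω) ∂P₂
      = ∫⁻ ω, Z ω 0 *
          (∫⁻ u in Set.Ioo (0 : ℝ) 1, g fun t => u⁻¹.toNNReal * (Z ω t / Z ω 0)) ∂P := by
  have := Measure.isProbabilityMeasure_map (μ := P₂) hR.aemeasurable
  have hlawR : P₂.map R = (volume.restrict (Set.Ioo (0 : ℝ) 1)).map (·⁻¹) :=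
    eq_map_inv_uniform fun r hr => by
      rw [Measure.map_apply hR measurableSet_Ioi]
      exact hR_survival r hr
  have hmul : Measurable fun p : ((Fin d → ℝ) → ℝ≥0) × ℝ => g fun t => p.2.toNNReal * p.1 t :=
    hg.comp (measurable_tailField measurable_snd measurable_fst)
  have hnorm : Measurable fun ω t => Z ω t / Z ω 0 :=
    measurable_pi_lambda _ fun t => (hZ t).div (hZ 0)
  have hinner : Measurable fun f : (Fin d → ℝ) → ℝ≥0 =>
      ∫⁻ r, g (fun t => r.toNNReal * f t) ∂P₂.map R := hmul.lintegral_prod_right'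
  calc ∫⁻ ω, g (tailField R Θ ω) ∂P₂
      = ∫⁻ ω, ∫⁻ r, g (fun t => r.toNNReal * Θ ω t) ∂P₂.map R ∂P₂ :=
        lintegral_comp_prodMk_of_indepFun hRΘ.symm hΘ hR hmul
    _ = ∫⁻ f, ∫⁻ r, g (fun t => r.toNNReal * f t) ∂P₂.map R ∂tiltedLaw P Z := by
        rw [← hΘ_law, lintegral_map hinner hΘ]
    _ = ∫⁻ ω, Z ω 0 * ∫⁻ r, g (fun t => r.toNNReal * (Z ω t / Z ω 0)) ∂P₂.map R ∂P := by
        rw [tiltedLaw, lintegral_map hinner hnorm]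
        exact lintegral_withDensity_eq_lintegral_mul _ (hZ 0).coe_nnreal_ennreal
          (hinner.comp hnorm)
    _ = _ := by
        refine lintegral_congr fun ω => ?_
        rw [hlawR]
        exact congrArg _ (lintegral_map (hmul.comp measurable_prodMk_left) measurable_inv)

theorem identDistrib_tailField_scaledField [IsProbabilityMeasure P₂]
    (hZ : Measurable Z) (hR : Measurable R)
    (hR_survival : ∀ r, 1 ≤ r → P₂ {ω | r < R ω} = ENNReal.ofReal (1 / r))
    (hΘ : Measurable Θ) (hΘ_law : P₂.map Θ = tiltedLaw P Z) (hRΘ : IndepFun R Θ P₂) :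
    IdentDistrib (tailField R Θ) (scaledField Z) P₂
      ((P.prod (volume.restrict (Set.Ioi 0))).restrict {p | 1 < scaledField Z p 0}) := by
  have hY := measurable_tailField hR hΘ
  have hX := measurable_scaledField hZ
  refine ⟨hY.aemeasurable, hX.aemeasurable, Measure.ext_of_lintegral _ fun g hg => ?_⟩
  rw [lintegral_map hg hY, lintegral_map hg hX, setLIntegral_one_lt_scaledField hZ 0 hg,
    lintegral_comp_tailField (fun t => (measurable_pi_apply t).comp hZ) hR hR_survival hΘ hΘ_law
      hRΘ hg]
  exact lintegral_congr fun ω => mul_setLIntegral_inv_mul_div (Z ω) 0 hg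

end TailField

section Berman

lemma sojourn_eq_exceedanceVolume_scaledField {Ω : Type*} {d : ℕ}
    (Z : Ω → (Fin d → ℝ) → ℝ≥0) (δ : ℝ) (A : Set (Fin d → ℝ)) (ω : Ω) {s : ℝ} (hs : 0 < s) :
    sojourn δ A (fun t => (Z ω t : ℝ)) s
      = exceedanceVolume (gridMeasure d δ) A (scaledField Z (ω, s)) := by
  rw [sojourn, exceedanceVolume]
  congr 2
  ext t
  rw [Set.mem_ofPred_eq, Set.mem_ofPred_eq, scaledField, one_lt_div (Real.toNNReal_pos.2 hs),
    Real.toNNReal_lt_iff_lt_coe hs.le]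

variable {Ω Ω₁ Ω₂ : Type*} [MeasurableSpace Ω] [MeasurableSpace Ω₁] [MeasurableSpace Ω₂]
  {P : Measure Ω} {P₁ : Measure Ω₁} {P₂ : Measure Ω₂} {d : ℕ} {Z : Ω → (Fin d → ℝ) → ℝ≥0}
  {V : ℕ → Ω₁ → ℝ} {W : ℕ → Ω₁ → (Fin d → ℝ) → ℝ≥0} {R : Ω₂ → ℝ}
  {Θ : Ω₂ → (Fin d → ℝ) → ℝ≥0} {δ x : ℝ}

lemma ae_isRightCont_scaledField (hZ_cont : ∀ᵐ ω ∂P, IsRightCont (Z ω)) :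
    ∀ᵐ p ∂P.prod (volume.restrict (Set.Ioi 0)), IsRightCont (scaledField Z p) := by
  filter_upwards [Measure.quasiMeasurePreserving_fst.ae hZ_cont] with p hp
  exact hp.div_const _

lemma bermanPre_eq_measure_lt_exceedanceVolume [SFinite P] (hZ : Measurable Z)
    (hZ_cont : ∀ᵐ ω ∂P, IsRightCont (Z ω)) (δ T x : ℝ) :
    bermanPre P Z δ T x = P.prod (volume.restrict (Set.Ioi 0))
      {p | ENNReal.ofReal x < exceedanceVolume (gridMeasure d δ) (cube d T) (scaledField Z p)} := by
  have hX := measurable_scaledField hZ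
  have hS := aemeasurable_exceedanceVolume (μ := gridMeasure d δ) (A := cube d T)
    hX.aemeasurable (ae_isRightCont_scaledField hZ_cont)
  have hSs (s : ℝ) : AEMeasurable (fun ω =>
      exceedanceVolume (gridMeasure d δ) (cube d T) (scaledField Z (ω, s))) P :=
    aemeasurable_exceedanceVolume (hX.comp measurable_prodMk_right).aemeasurable
      (hZ_cont.mono fun ω hω => hω.div_const _)
  have hE := nullMeasurableSet_lt (aemeasurable_const (b := ENNReal.ofReal x)) hS
  rw [← lintegral_indicator_one₀ hE,
    lintegral_prod_symm _ (AEMeasurable.indicator₀ (f := 1) aemeasurable_const hE), bermanPre]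
  refine setLIntegral_congr_fun measurableSet_Ioi fun s hs => ?_
  simp only [sojourn_eq_exceedanceVolume_scaledField _ _ _ _ (Set.mem_Ioi.1 hs)]
  exact (lintegral_indicator_one₀ (nullMeasurableSet_lt aemeasurable_const (hSs s))).symm

theorem tendsto_bermanPre_div [IsProbabilityMeasure P] [IsProbabilityMeasure P₁]
    [IsProbabilityMeasure P₂] (hZ : Measurable Z) (hZ_cont : ∀ᵐ ω ∂P, IsRightCont (Z ω))
    (hZ_mean : ∀ t, ∫⁻ ω, (Z ω t : ℝ≥0∞) ∂P ≠ ∞) (hVW : IsDeHaanSample P Z P₁ V W)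
    (hst : IsStationaryField P₁ (deHaanField V W)) (hR : Measurable R)
    (hR_survival : ∀ r, 1 ≤ r → P₂ {ω | r < R ω} = ENNReal.ofReal (1 / r))
    (hΘ : Measurable Θ) (hΘ_cont : ∀ᵐ ω ∂P₂, IsRightCont (Θ ω))
    (hΘ_law : P₂.map Θ = tiltedLaw P Z) (hRΘ : IndepFun R Θ P₂) (hδ : 0 ≤ δ) (hx : 0 < x) :
    Tendsto (fun T : ℝ => bermanPre P Z δ T x / ENNReal.ofReal (T ^ d)) atTop
      (𝓝 (∫⁻ ω, truncInv (ENNReal.ofReal x) (sojournY δ R Θ ω) ∂P₂)) := by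
  have hX_cont := ae_isRightCont_scaledField hZ_cont
  have hX_fin : P.prod (volume.restrict (Set.Ioi 0)) {p | 1 < scaledField Z p 0} ≠ ∞ := by
    have := measure_exists_lt_scaledField (P := P) (t := fun _ : Fin 1 => (0 : Fin d → ℝ)) hZ
      fun _ => one_pos
    simp only [exists_const] at this
    exact this ▸ lintegral_maxRatio_ne_top _ _ hZ hZ_mean
  have hlaw := (identDistrib_exceedanceVolume (μ := gridMeasure d δ) (A := Set.univ)
    (identDistrib_tailField_scaledField hZ hR hR_survival hΘ hΘ_law hRΘ)
    (hΘ_cont.mono fun ω hω => hω.const_mul _) (ae_restrict_of_ae hX_cont)).comp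
      (measurable_truncInv (ENNReal.ofReal x))
  simp only [bermanPre_eq_measure_lt_exceedanceVolume hZ hZ_cont, sojournY_eq_exceedanceVolume]
  exact hlaw.lintegral_eq ▸ (hasStationaryExceedances_scaledField hZ hZ_mean hVW
    hst).tendsto_measure_lt_exceedanceVolume_div (measurable_scaledField hZ) hX_cont hX_fin
      (ae_measurePreserving_gridMeasure δ) (isCubeNormalized_gridMeasure hδ)
      (ENNReal.ofReal_pos.2 hx).ne'

end Berman

theorem mainTheorem7_general {Ω Ω₁ Ω₂ : Type*}
    [MeasurableSpace Ω] [MeasurableSpace Ω₁] [MeasurableSpace Ω₂]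
    (P : Measure Ω) [IsProbabilityMeasure P]
    (P₁ : Measure Ω₁) [IsProbabilityMeasure P₁]
    (P₂ : Measure Ω₂) [IsProbabilityMeasure P₂]
    (d : ℕ) (Z : Ω → (Fin d → ℝ) → ℝ≥0)
    (hZ : Measurable Z) (hZ_cont : ∀ᵐ ω ∂P, IsRightCont (Z ω))
    (hZ_mean : ∀ t, ∫⁻ ω, (Z ω t : ℝ≥0∞) ∂P ≠ ∞)
    (V : ℕ → Ω₁ → ℝ) (W : ℕ → Ω₁ → (Fin d → ℝ) → ℝ≥0) (hVW : IsDeHaanSample P Z P₁ V W)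
    (hX : IsStationaryField P₁ (deHaanField V W))
    (R : Ω₂ → ℝ) (Θ : Ω₂ → (Fin d → ℝ) → ℝ≥0) (hR : Measurable R)
    (hR_survival : ∀ r, 1 ≤ r → P₂ {ω | r < R ω} = ENNReal.ofReal (1 / r))
    (hΘ : Measurable Θ) (hΘ_cont : ∀ᵐ ω ∂P₂, IsRightCont (Θ ω))
    (hΘ_law : P₂.map Θ = tiltedLaw P Z) (hRΘ : IndepFun R Θ P₂)
    (δ : ℝ) (hδ : 0 ≤ δ) (x : ℝ) (hx : 0 < x) :
    Tendsto (fun T : ℝ => bermanPre P Z δ T x / ENNReal.ofReal (T ^ d)) atTop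
        (𝓝 (bermanFun P Z δ x)) ∧
      P₂ {ω | ENNReal.ofReal x < sojournY δ R Θ ω} ^ 2 / ∫⁻ ω, sojournY δ R Θ ω ∂P₂
        ≤ bermanFun P Z δ x ∧
      bermanFun P Z δ x
        ≤ (ENNReal.ofReal x)⁻¹ * P₂ {ω | ENNReal.ofReal x ≤ sojournY δ R Θ ω} := by
  have hlim := tendsto_bermanPre_div hZ hZ_cont hZ_mean hVW hX hR hR_survival hΘ hΘ_cont hΘ_law
    hRΘ hδ hx
  have hS : AEMeasurable (sojournY δ R Θ) P₂ := by
    simp only [funext (sojournY_eq_exceedanceVolume δ R Θ)]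
    exact aemeasurable_exceedanceVolume (measurable_tailField hR hΘ).aemeasurable
      (hΘ_cont.mono fun ω hω => hω.const_mul _)
  rw [show bermanFun P Z δ x = _ from hlim.limUnder_eq]
  exact ⟨hlim, sq_measure_lt_div_lintegral_le hS _, lintegral_truncInv_le hS _⟩

theorem mainTheorem7 {Ω Ω₁ Ω₂ : Type*}
    [MeasurableSpace Ω] [MeasurableSpace Ω₁] [MeasurableSpace Ω₂]
    (P : Measure Ω) [IsProbabilityMeasure P]
    (P₁ : Measure Ω₁) [IsProbabilityMeasure P₁]
    (P₂ : Measure Ω₂) [IsProbabilityMeasure P₂]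
    (d : ℕ) (hd : 1 ≤ d)
    (Z : Ω → (Fin d → ℝ) → ℝ≥0) (hZ : IsSpectralField P Z)
    (V : ℕ → Ω₁ → ℝ) (W : ℕ → Ω₁ → (Fin d → ℝ) → ℝ≥0) (hVW : IsDeHaanSample P Z P₁ V W)
    (hX : IsStationaryField P₁ (deHaanField V W))
    (R : Ω₂ → ℝ) (Θ : Ω₂ → (Fin d → ℝ) → ℝ≥0) (hRΘ : IsParetoTilted P Z P₂ R Θ)
    (δ : ℝ) (hδ : 0 ≤ δ) (x : ℝ) (hx : 0 < x) :
    Tendsto (fun T : ℝ => bermanPre P Z δ T x / ENNReal.ofReal (T ^ d)) atTop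
        (𝓝 (bermanFun P Z δ x)) ∧
      P₂ {ω | ENNReal.ofReal x < sojournY δ R Θ ω} ^ 2 / ∫⁻ ω, sojournY δ R Θ ω ∂P₂
        ≤ bermanFun P Z δ x ∧
      bermanFun P Z δ x
        ≤ (ENNReal.ofReal x)⁻¹ * P₂ {ω | ENNReal.ofReal x ≤ sojournY δ R Θ ω} :=
  mainTheorem7_general P P₁ P₂ d Z (measurable_pi_lambda _ hZ.measurable)
    (hZ.cadlag.mono fun _ hω => hω.isRightCont) (fun t => hZ.mean_one t ▸ ENNReal.one_ne_top)
    V W hVW hX R Θ hRΘ.measurable_R hRΘ.survival_R hRΘ.measurable_Θ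
    (hRΘ.cadlag_Θ.mono fun _ hω => hω.isRightCont) hRΘ.law_Θ hRΘ.indep δ hδ x hx
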